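/- Let $E$ be a finite nonempty set of edges with positive lengths $l:E\to\mathbb{R}_{>0}$ that are pairwise commensurable (all ratios $l(e)/l(f)$ are rational). A $DP$-system constructed from $E$ is a connected graph $\Gamma$ whose edge set is exactly $E$, where every edge joins two distinct vertices and parallel edges are allowed, together with a nonempty set of vertices each of which holds a dynamic point at time $0$. The system evolves as follows. A point located in a vertex $v$ disappears and produces one new point on every edge incident to $v$; the new point moves along that edge away from $v$ with unit speed. When one or more points reach a vertex at the same time they fuse, and again one new point is produced on every edge incident to this vertex. Points that meet inside an edge do not interact. The stabilization time of the system is the least $T\ge 0$ such that the number $N(t)$ of points on the edges is constant for $t\ge T$, where the times at which two or more points reach one vertex simultaneously are left out (points produced at time $T$ being counted in $N(T)$). Let $\mathit{LSTDP}(E)$ be the set of all $DP$-systems constructed from $E$ whose stabilization time is the largest among all $DP$-systems constructed from $E$. Then $\mathit{LSTDP}(E)$ contains a $DP$-system such that its graph is a bead graph, i.e. no vertex belongs to two different cycles (two parallel edges form a cycle), every vertex has degree at most three, and there is exactly one initial point, which is placed in a terminal vertex, i.e. in a vertex of degree one. -/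

import Mathlib

namespace DynamicPoints

universe u v w

section Graphs

variable {V : Type v} {E : Type w}

/-- Any two vertices of the multigraph `G` are joined by a walk. -/
def IsConnected (G : Graph V E) : Prop :=
  ∀ ⦃x y : V⦄, x ∈ G.vertexSet → y ∈ G.vertexSet → Relation.ReflTransGen G.Adj x y

/-- The degree of a vertex: the number of incident edges (used for graphs without loops). -/
noncomputable def degree (G : Graph V E) (x : V) : ℕ∞ :=
  (G.incidenceSet x).encard

/-- A terminal vertex: a vertex with exactly one incident edge. -/
def IsTerminal (G : Graph V E) (x : V) : Prop :=
  x ∈ G.vertexSet ∧ degree G x = 1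

/-- `x 0, e 0, x 1, e 1, …, x (n - 1), e (n - 1), x n = x 0` is a cycle of length `n ≥ 1` of `G`:
a closed walk whose edges are distinct and whose vertices `x 0, …, x (n - 1)` are distinct. Two
parallel edges form a cycle of length `2`. -/
structure IsCycle (G : Graph V E) (n : ℕ) (x : ℕ → V) (e : ℕ → E) : Prop where
  pos : 1 ≤ n
  closed : x n = x 0
  link : ∀ i < n, G.IsLink (e i) (x i) (x (i + 1))
  vertex_inj : Set.InjOn x (Set.Iio n)
  edge_inj : Set.InjOn e (Set.Iio n)

/-- A bead graph: no vertex belongs to two different cycles. Two closed sequences describe the same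
cycle (up to the starting vertex and the direction) when they have the same set of edges. -/
def IsBead (G : Graph V E) : Prop :=
  ∀ (n : ℕ) (x : ℕ → V) (e : ℕ → E) (m : ℕ) (y : ℕ → V) (f : ℕ → E),
    IsCycle G n x e → IsCycle G m y f →
    (∃ i < n, ∃ j < m, x i = y j) → e '' Set.Iio n = f '' Set.Iio m

end Graphs

/-- A system of dynamic points constructed from the set of edges `E`: a connected multigraph
without loops whose edges are exactly the elements of `E`, with a nonempty set of vertices that
hold a dynamic point at time `0`. Parallel edges are allowed. -/
structure DPSystem (E : Type u) where
  Vertex : Type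
  graph : Graph Vertex E
  edgeSet_eq : graph.edgeSet = Set.univ
  loopless : graph.Loopless
  connected : IsConnected graph
  initial : Set Vertex
  initial_subset : initial ⊆ graph.vertexSet
  initial_nonempty : initial.Nonempty

namespace DPSystem

variable {E : Type u}

/-- `P.Scatters l x t`: at time `t` a dynamic point is located in the vertex `x` and scatters, that
is, one new point is produced on every arc outgoing from `x`. This happens at time `0` in the
initial vertices, and later whenever some point, moving with unit speed along an edge `e` of length
`l e`, reaches `x`. Points that reach `x` at the same time fuse. -/
inductive Scatters (P : DPSystem E) (l : E → ℝ) : P.Vertex → ℝ → Prop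
  | start {x : P.Vertex} (hx : x ∈ P.initial) : Scatters P l x 0
  | arrive {x y : P.Vertex} {t : ℝ} {e : E} (hx : Scatters P l x t)
      (he : P.graph.IsLink e x y) : Scatters P l y (t + l e)

/-- The dynamic points at time `t`. The triple `(e, x, s)` is the point that was produced at time
`s` in the end `x` of the edge `e` and moves along `e` away from `x` during `[s, s + l e)`. -/
def points (P : DPSystem E) (l : E → ℝ) (t : ℝ) : Set (E × P.Vertex × ℝ) :=
  {p | P.graph.Inc p.1 p.2.1 ∧ P.Scatters l p.2.1 p.2.2 ∧ p.2.2 ≤ t ∧ t < p.2.2 + l p.1}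

/-- The number of dynamic points at time `t`. -/
noncomputable def numPoints (P : DPSystem E) (l : E → ℝ) (t : ℝ) : ℕ∞ :=
  (P.points l t).encard

/-- A point that was produced in the end `x` of `e` reaches the vertex `y` at time `t`
along `e`. -/
def Reaches (P : DPSystem E) (l : E → ℝ) (e : E) (x y : P.Vertex) (t : ℝ) : Prop :=
  P.graph.IsLink e x y ∧ P.Scatters l x (t - l e)

/-- The collision times: more than one dynamic point reaches some vertex. -/
def collisionTimes (P : DPSystem E) (l : E → ℝ) : Set ℝ :=
  {t | ∃ (y : P.Vertex) (e : E) (x : P.Vertex) (e' : E) (x' : P.Vertex),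
    (e, x) ≠ (e', x') ∧ P.Reaches l e x y t ∧ P.Reaches l e' x' y t}

/-- `T` is the stabilization time of `P`: the earliest time from which on the number of dynamic
points does not change, where collision times are left out. -/
def IsStabilizationTime (P : DPSystem E) (l : E → ℝ) (T : ℝ) : Prop :=
  IsLeast {T : ℝ | 0 ≤ T ∧
    ∀ t, T ≤ t → t ∉ P.collisionTimes l → P.numPoints l t = P.numPoints l T} T

end DPSystem

/-- The set of systems constructed from the edges `E` with lengths `l` that have the longest
stabilization time: such a system stabilizes, and every system constructed from `E` stabilizes and
does so no later. -/
def LSTDP {E : Type u} (l : E → ℝ) : Set (DPSystem E) :=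
  {P | ∃ T : ℝ, P.IsStabilizationTime l T ∧
    ∀ Q : DPSystem E, ∃ T' ≤ T, Q.IsStabilizationTime l T'}

/-- All ratios of lengths are rational. -/
def Commensurable {E : Type u} (l : E → ℝ) : Prop :=
  ∀ e f : E, ∃ q : ℚ, l e / l f = q

end DynamicPoints

/-! In a common unit the lengths are positive integers `n e` with gcd 1, and a vertex holds a point
at time `k` exactly when a walk of length `k` leads to it from an initial vertex. A point that
reaches an end of its edge can be followed as bouncing back along this edge, so the count grows
exactly when a vertex `y` emits a point on an edge `e = xy` along which nothing arrives
(`Unstable`). The stabilization time is the last such time. Walks can be prolonged by going back and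
forth along edges; hence all late times of an occurring parity occur at a vertex, uniformly in the
system, and the unstable times of all systems have a maximum `K`.

It remains to turn a system unstable at `K` into one of the required shape unstable at some `k ≥ K`.
Say `x` is not occupied at `K - n e`. It is enough to find a system of the required shape with an
end `x'` of `e` whose occupation times in this parity class exist and all are occupation times of
`x` (`exists_isTerminalBead`): the first time occupied among `K + n e`, `K + 3 n e`, ... yields an
instability (`exists_isTerminalBead_unstable`).

For the construction, take a walk to `x` with fewest edges among those of the given parity. Either
it repeats no edge, or it uses edges `Q` once, `M` twice and `Z` once, with `Z` of odd length
(`Cover.exists_parity`). In the first case the edges are lined up in a path. In the second, `Q` and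
`M` form a stem, `Z` a cycle at its end, and the other edges a tail; `x'` lies between `Q` and `M`.
A walk in the new graph is imitated in the old one by detours back and forth along edges that touch
those already traversed (`walk_path_bound`, `walk_chord_bound`). -/

namespace DynamicPoints

universe u v w

/-! ### Walks with fewest edges in a parity class. -/

section Walks

variable {V : Type v} {E : Type w} {G : Graph V E}

/-- There is a walk of `G` from `x` to `y` that traverses the edges `L` in this order. -/
inductive Walk (G : Graph V E) : V → List E → V → Prop
  | nil (x : V) : Walk G x [] x
  | cons {x y z : V} {e : E} {L : List E} (h : G.IsLink e x y) (hL : Walk G y L z) :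
      Walk G x (e :: L) z

theorem walk_nil_iff {x y : V} : Walk G x [] y ↔ x = y := by
  refine ⟨fun h => ?_, fun h => h ▸ Walk.nil x⟩
  cases h
  rfl

theorem walk_cons_iff {x z : V} {e : E} {L : List E} :
    Walk G x (e :: L) z ↔ ∃ y, G.IsLink e x y ∧ Walk G y L z := by
  refine ⟨fun h => ?_, fun ⟨y, h, hL⟩ => Walk.cons h hL⟩
  cases h with
  | cons h hL => exact ⟨_, h, hL⟩

theorem walk_append_iff {x z : V} {L M : List E} :
    Walk G x (L ++ M) z ↔ ∃ y, Walk G x L y ∧ Walk G y M z := by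
  induction L generalizing x with
  | nil => simp [walk_nil_iff]
  | cons e L ih =>
    simp only [List.cons_append, walk_cons_iff, ih]
    constructor
    · rintro ⟨y, h, a, hL, hM⟩
      exact ⟨a, ⟨y, h, hL⟩, hM⟩
    · rintro ⟨a, ⟨y, h, hL⟩, hM⟩
      exact ⟨y, h, a, hL, hM⟩

theorem Walk.reverse {x y : V} {L : List E} (h : Walk G x L y) : Walk G y L.reverse x := by
  induction h with
  | nil x => exact Walk.nil x
  | cons h _ ih =>
    rw [List.reverse_cons, walk_append_iff]
    exact ⟨_, ih, walk_cons_iff.2 ⟨_, h.symm, Walk.nil _⟩⟩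

/-- A walk that traverses an edge can be split at any end of this edge. -/
theorem Walk.exists_split {x y w : V} {L : List E} {e : E} (h : Walk G x L y) (he : e ∈ L)
    (hw : G.Inc e w) : ∃ A B, L = A ++ B ∧ Walk G x A w ∧ Walk G w B y := by
  obtain ⟨A, B, rfl⟩ := List.append_of_mem he
  obtain ⟨p, hA, hp⟩ := walk_append_iff.1 h
  obtain ⟨q, hq, hB⟩ := walk_cons_iff.1 hp
  obtain rfl | rfl := hw.eq_or_eq_of_isLink hq
  · exact ⟨A, e :: B, rfl, hA, hp⟩
  · exact ⟨A ++ [e], B, by simp, walk_append_iff.2 ⟨p, hA, walk_cons_iff.2 ⟨_, hq, Walk.nil _⟩⟩, hB⟩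

/-- The total length of a list of edges. -/
def weight (n : E → ℕ) (L : List E) : ℕ := (L.map n).sum

@[simp] theorem weight_nil (n : E → ℕ) : weight n [] = 0 := rfl

@[simp] theorem weight_cons (n : E → ℕ) (e : E) (L : List E) :
    weight n (e :: L) = n e + weight n L := by simp [weight]

@[simp] theorem weight_append (n : E → ℕ) (L M : List E) :
    weight n (L ++ M) = weight n L + weight n M := by simp [weight]

@[simp] theorem weight_reverse (n : E → ℕ) (L : List E) : weight n L.reverse = weight n L := by
  simp [weight]

/-- A walk with the least number of edges among the walks whose length has the same parity. -/
def IsShortest (G : Graph V E) (n : E → ℕ) (x : V) (L : List E) (y : V) : Prop :=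
  Walk G x L y ∧
    ∀ M, Walk G x M y → weight n M % 2 = weight n L % 2 → L.length ≤ M.length

theorem Walk.exists_isShortest (n : E → ℕ) {x y : V} {L : List E} (h : Walk G x L y) :
    ∃ M, IsShortest G n x M y ∧ weight n M % 2 = weight n L % 2 := by
  classical
  have hex : ∃ k, ∃ M, Walk G x M y ∧ weight n M % 2 = weight n L % 2 ∧ M.length = k :=
    ⟨_, L, h, rfl, rfl⟩
  obtain ⟨M, hM, hpar, hlen⟩ := Nat.find_spec hex
  refine ⟨M, ⟨hM, fun M' hM' hpar' => ?_⟩, hpar⟩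
  rw [hlen]
  exact Nat.find_min' hex ⟨M', hM', hpar'.trans hpar, rfl⟩

/-- If both traversals had the same direction, reversing `B` and dropping both `m` would shorten the
walk. With opposite directions `B` is closed, and an even `B` could be cut out together with both
`m`. -/
theorem IsShortest.repeat {n : E → ℕ} {x y : V} {A B C : List E} {m : E}
    (h : IsShortest G n x (A ++ m :: (B ++ m :: C)) y) :
    ∃ p q, Walk G x A p ∧ G.IsLink m p q ∧ Walk G q B q ∧ G.IsLink m q p ∧ Walk G p C y ∧
      weight n B % 2 = 1 := by
  obtain ⟨hw, hmin⟩ := h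
  obtain ⟨p, hA, hw⟩ := walk_append_iff.1 hw
  obtain ⟨q, hpq, hw⟩ := walk_cons_iff.1 hw
  obtain ⟨r, hB, hw⟩ := walk_append_iff.1 hw
  obtain ⟨s, hrs, hC⟩ := walk_cons_iff.1 hw
  obtain ⟨rfl, rfl⟩ | ⟨rfl, rfl⟩ := hpq.eq_and_eq_or_eq_and_eq hrs
  · have := hmin (A ++ (B.reverse ++ C))
      (walk_append_iff.2 ⟨_, hA, walk_append_iff.2 ⟨_, hB.reverse, hC⟩⟩) (by simp; omega)
    simp at this
  · refine ⟨p, q, hA, hpq, hB, hrs, hC, ?_⟩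
    by_contra hodd
    have := hmin (A ++ C) (walk_append_iff.2 ⟨_, hA, hC⟩) (by simp; omega)
    simp at this
    omega

theorem Walk.right_unique {x y z : V} {L : List E} (h : Walk G x L y) (h' : Walk G x L z) :
    y = z := by
  induction h with
  | nil x => exact walk_nil_iff.1 h'
  | cons h _ ih =>
    obtain ⟨_, hl, h'⟩ := walk_cons_iff.1 h'
    obtain rfl := h.right_unique hl
    exact ih h'

/-- Any two traversals have opposite directions, which is impossible for three. -/
theorem IsShortest.not_thrice [G.Loopless] {n : E → ℕ} {x y : V} {A B C D : List E} {m : E}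
    (h : IsShortest G n x (A ++ m :: (B ++ m :: (C ++ m :: D))) y) : False := by
  obtain ⟨p, q, hA, hpq, hB, hqp, -, -⟩ := h.repeat
  have h₁ : IsShortest G n x (A ++ m :: ((B ++ m :: C) ++ m :: D)) y := by simpa using h
  obtain ⟨p₁, q₁, hA₁, hpq₁, hB₁, -⟩ := h₁.repeat
  have h₂ : IsShortest G n x ((A ++ m :: B) ++ m :: (C ++ m :: D)) y := by simpa using h
  obtain ⟨p₂, q₂, hA₂, hpq₂, hC₂, -⟩ := h₂.repeat
  obtain rfl := hA.right_unique hA₁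
  obtain rfl := hpq.right_unique hpq₁
  obtain rfl := hA₂.right_unique (walk_append_iff.2 ⟨_, hA, walk_cons_iff.2 ⟨_, hpq, hB⟩⟩)
  obtain rfl := hqp.right_unique hpq₂
  obtain ⟨_, hB', hC'⟩ := walk_append_iff.1 hB₁
  obtain rfl := hB.right_unique hB'
  obtain ⟨_, hm, hC'⟩ := walk_cons_iff.1 hC'
  obtain rfl := hqp.right_unique hm
  exact hpq.ne (hC₂.right_unique hC')

/-- Since repeated edges reverse direction, the parts fit together as `A D C B F`, which saves four
traversals and an even length. -/
theorem IsShortest.not_interleaved {n : E → ℕ} {x y : V} {A B C D F : List E} {m m' : E}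
    (h : IsShortest G n x (A ++ m :: (B ++ m' :: (C ++ m :: (D ++ m' :: F)))) y) : False := by
  have h₁ : IsShortest G n x (A ++ m :: ((B ++ m' :: C) ++ m :: (D ++ m' :: F))) y := by
    simpa using h
  obtain ⟨p, q, hA, hpq, hBC, hqp, hDF, -⟩ := h₁.repeat
  have h₂ : IsShortest G n x ((A ++ m :: B) ++ m' :: ((C ++ m :: D) ++ m' :: F)) y := by
    simpa using h
  obtain ⟨a, b, hAB, hab, hCD, -, hF, -⟩ := h₂.repeat
  obtain ⟨a', hB, hC⟩ := walk_append_iff.1 hBC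
  obtain ⟨b', hab', hC⟩ := walk_cons_iff.1 hC
  obtain rfl := hAB.right_unique (walk_append_iff.2 ⟨_, hA, walk_cons_iff.2 ⟨_, hpq, hB⟩⟩)
  obtain rfl := hab.right_unique hab'
  obtain ⟨q', hC', hD⟩ := walk_append_iff.1 hCD
  obtain rfl := hC.right_unique hC'
  obtain ⟨p', hqp', hD⟩ := walk_cons_iff.1 hD
  obtain rfl := hqp.right_unique hqp'
  have := h.2 (A ++ (D ++ (C ++ (B ++ F)))) (walk_append_iff.2 ⟨_, hA, walk_append_iff.2
    ⟨_, hD, walk_append_iff.2 ⟨_, hC, walk_append_iff.2 ⟨_, hB, hF⟩⟩⟩⟩) (by simp; omega)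
  simp at this
  omega

/-- A repetition at least distance encloses no other repetition. -/
theorem exists_repeat_of_not_nodup {L : List E} (h : ¬ L.Nodup) :
    ∃ A B C m, L = A ++ m :: (B ++ m :: C) ∧ B.Nodup := by
  classical
  have hex : ∀ L : List E, ¬ L.Nodup → ∃ A B C m, L = A ++ m :: (B ++ m :: C) := by
    intro L hL
    induction L with
    | nil => simp at hL
    | cons e L ih =>
      by_cases he : e ∈ L
      · obtain ⟨B, C, rfl⟩ := List.append_of_mem he
        exact ⟨[], B, C, e, rfl⟩
      · obtain ⟨A, B, C, m, rfl⟩ := ih fun h => hL (List.nodup_cons.2 ⟨he, h⟩)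
        exact ⟨e :: A, B, C, m, rfl⟩
  have hk : ∃ k A B C m, L = A ++ m :: (B ++ m :: C) ∧ B.length = k := by
    obtain ⟨A, B, C, m, hL⟩ := hex L h
    exact ⟨_, A, B, C, m, hL, rfl⟩
  obtain ⟨A, B, C, m, rfl, hlen⟩ := Nat.find_spec hk
  refine ⟨A, B, C, m, rfl, ?_⟩
  by_contra hB
  obtain ⟨A', B', C', m', rfl⟩ := hex B hB
  have := Nat.find_min' hk ⟨A ++ m :: A', B', C' ++ m :: C, m', by simp, rfl⟩
  rw [← hlen] at this
  simp at this
  omega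

/-- An edge between two traversals of `m` in a shortest walk is traversed only once, if it is
traversed once between these traversals. -/
theorem IsShortest.not_mem_of_mem [G.Loopless] {n : E → ℕ} {x y : V} {A B C : List E} {m : E}
    (h : IsShortest G n x (A ++ m :: (B ++ m :: C)) y) {z : E} (hz : z ∈ B) :
    z ∉ A ∧ z ≠ m ∧ z ∉ C := by
  obtain ⟨B, B', rfl⟩ := List.append_of_mem hz
  refine ⟨fun hA => ?_, ?_, fun hC => ?_⟩
  · obtain ⟨A, A', rfl⟩ := List.append_of_mem hA
    exact IsShortest.not_interleaved (A := A) (B := A') (C := B) (D := B') (F := C) (m := z)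
      (m' := m) (by simpa using h)
  · rintro rfl
    exact IsShortest.not_thrice (A := A) (B := B) (C := B') (D := C) (m := z) (by simpa using h)
  · obtain ⟨C, C', rfl⟩ := List.append_of_mem hC
    exact IsShortest.not_interleaved (A := A) (B := B) (C := B') (D := C) (F := C') (m := m)
      (m' := z) (by simpa using h)

/-- The end of a shortest walk is not an end of an edge of an odd closed part of this walk. -/
theorem IsShortest.not_inc {n : E → ℕ} {x y : V} {A B C : List E} {m : E}
    (h : IsShortest G n x (A ++ m :: (B ++ m :: C)) y) {z : E} (hz : z ∈ B) : ¬ G.Inc z y := by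
  intro hy
  obtain ⟨p, q, hA, hpq, hB, hqp, hC, hodd⟩ := h.repeat
  obtain ⟨B, B', rfl, hqy, hyq⟩ := hB.exists_split hz hy
  have hlen : 0 < B.length + B'.length := by
    have := List.length_pos_of_mem hz
    simpa using this
  -- The two ways round the odd closed part to `y` differ in parity, so one of them has the parity
  -- of the whole walk and is shorter.
  have h₁ := h.2 (A ++ m :: B) (walk_append_iff.2 ⟨_, hA, walk_cons_iff.2 ⟨_, hpq, hqy⟩⟩)
  have h₂ := h.2 (A ++ m :: B'.reverse)
    (walk_append_iff.2 ⟨_, hA, walk_cons_iff.2 ⟨_, hpq, hyq.reverse⟩⟩)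
  simp at h₁ h₂ hodd
  omega

end Walks

/-! ### Multiplicities of edges in a walk. -/

section Weights

variable {E : Type u}

theorem weight_toList (n : E → ℕ) (s : Finset E) : weight n s.toList = ∑ e ∈ s, n e := by
  simp [weight]

theorem Perm.weight_eq {n : E → ℕ} {L M : List E} (h : L.Perm M) : weight n L = weight n M :=
  (h.map n).sum_eq

theorem weight_le_sum [Fintype E] (n : E → ℕ) {L : List E} (h : L.Nodup) :
    weight n L ≤ ∑ e, n e := by
  classical
  rw [weight, ← List.sum_toFinset n h]
  exact Finset.sum_le_sum_of_subset (Finset.subset_univ _)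

theorem exists_eq_append_cons_of_count [DecidableEq E] {L : List E} {e : E} {k : ℕ}
    (h : k < L.count e) : ∃ A R, L = A ++ e :: R ∧ k ≤ R.count e := by
  obtain ⟨A, R, rfl, hA⟩ := List.eq_append_cons_of_mem
    (List.count_pos_iff.1 (Nat.zero_lt_of_lt h))
  refine ⟨A, R, rfl, ?_⟩
  simp [List.count_append, List.count_eq_zero_of_not_mem hA] at h
  omega

/-- Only multiplicities enter the rearranged graph: `M` collects the edges used twice and `P` those
used once outside `Z`. -/
theorem weight_eq_of_count_le_two [DecidableEq E] (n : E → ℕ) {L Z : List E} (hZ : Z.Nodup)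
    (hZL : ∀ z ∈ Z, L.count z = 1) (hL : ∀ e, L.count e ≤ 2) :
    ∃ P M : List E, (P ++ M ++ Z).Nodup ∧ (∀ e, e ∈ P ++ M ++ Z ↔ e ∈ L) ∧
      (∀ e, e ∈ M ↔ L.count e = 2) ∧ weight n L = weight n P + 2 * weight n M + weight n Z := by
  set S := L.toFinset with hS
  set M := S.filter fun e => L.count e = 2
  set P := S.filter fun e => L.count e ≠ 2 ∧ e ∉ Z
  have hmem : ∀ e, e ∈ P ∨ e ∈ M ∨ e ∈ Z ↔ e ∈ L := by
    intro e
    have := hZL e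
    have h1 : L.count e ≠ 0 ↔ e ∈ L := by simp [List.count_eq_zero]
    simp only [P, M, hS, Finset.mem_filter, List.mem_toFinset]
    grind
  have hPM : Disjoint P M := by
    simp only [P, M, Finset.disjoint_left, Finset.mem_filter]
    grind
  have hPZ : Disjoint P Z.toFinset := by
    simp only [P, Finset.disjoint_left, Finset.mem_filter, List.mem_toFinset]
    grind
  have hMZ : Disjoint M Z.toFinset := by
    simp only [M, Finset.disjoint_left, Finset.mem_filter, List.mem_toFinset]
    grind
  refine ⟨P.toList, M.toList, ?_, ?_, ?_, ?_⟩
  · simp only [List.nodup_append', P.nodup_toList, M.nodup_toList, hZ, true_and,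
      List.disjoint_left, List.mem_append, Finset.mem_toList]
    simp only [Finset.disjoint_left, List.mem_toFinset] at hPM hPZ hMZ
    grind
  · simpa [or_assoc] using hmem
  · intro e
    have h1 : L.count e ≠ 0 ↔ e ∈ L := by simp [List.count_eq_zero]
    simp only [M, hS, Finset.mem_toList, Finset.mem_filter, List.mem_toFinset]
    grind
  · have hSU : S = P ∪ M ∪ Z.toFinset := by
      ext e
      simp [hS, ← hmem e]
    have hone : ∀ e ∈ P, L.count e = 1 := by
      intro e he
      simp only [P, hS, Finset.mem_filter, List.mem_toFinset] at he
      have h1 : L.count e ≠ 0 ↔ e ∈ L := by simp [List.count_eq_zero]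
      have := hL e
      grind
    rw [weight, Finset.sum_list_map_count, ← hS, hSU, Finset.sum_union, Finset.sum_union hPM,
      weight_toList, weight_toList, weight, ← List.sum_toFinset n hZ, Finset.mul_sum]
    · refine congrArg₂ _ (congrArg₂ _ ?_ ?_) ?_
      · exact Finset.sum_congr rfl fun e he => by simp [hone e he]
      · exact Finset.sum_congr rfl fun e he => by simp [(Finset.mem_filter.1 he).2]
      · exact Finset.sum_congr rfl fun e he => by simp [hZL e (List.mem_toFinset.1 he)]
    · exact Finset.disjoint_union_left.2 ⟨hPZ, hMZ⟩

end Weights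

/-! ### Walks from initial vertices and detours. -/

namespace DPSystem

variable {E : Type u}

instance (P : DPSystem E) : P.graph.Loopless := P.loopless

/-- Some walk of length `k` leads from an initial vertex of `P` to `x` and traverses all edges
in the list `C`. -/
def Cover (P : DPSystem E) (n : E → ℕ) (x : P.Vertex) (C : List E) (k : ℕ) : Prop :=
  ∃ v ∈ P.initial, ∃ L, Walk P.graph v L x ∧ (∀ f ∈ C, f ∈ L) ∧ weight n L = k

variable {P : DPSystem E} {n : E → ℕ} {x : P.Vertex} {C D : List E} {k : ℕ}

theorem Cover.mono (h : P.Cover n x C k) (hD : ∀ f ∈ D, f ∈ C) : P.Cover n x D k := by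
  obtain ⟨v, hv, L, hL, hC, hk⟩ := h
  exact ⟨v, hv, L, hL, fun f hf => hC f (hD f hf), hk⟩

theorem exists_inc (P : DPSystem E) (e : E) : ∃ x, P.graph.Inc e x := by
  have : e ∈ P.graph.edgeSet := P.edgeSet_eq ▸ Set.mem_univ e
  obtain ⟨x, y, h⟩ := P.graph.exists_isLink_of_mem_edgeSet this
  exact ⟨x, y, h⟩

/-- The edge `f` has an end that is `x` or an end of an edge in the list `C`. -/
def Touches (P : DPSystem E) (x : P.Vertex) (C : List E) (f : E) : Prop :=
  ∃ w, P.graph.Inc f w ∧ (w = x ∨ ∃ g ∈ C, P.graph.Inc g w)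

theorem touches_of_mem {f : E} (hf : f ∈ C) : P.Touches x C f := by
  obtain ⟨w, hw⟩ := P.exists_inc f
  exact ⟨w, hw, Or.inr ⟨f, hf, hw⟩⟩

/-- Traversing an edge back and forth. -/
theorem Cover.touch {f : E} (h : P.Cover n x C k) (hf : P.Touches x C f) :
    P.Cover n x (f :: C) (k + 2 * n f) := by
  obtain ⟨v, hv, L, hL, hC, rfl⟩ := h
  obtain ⟨w, ⟨y, hfw⟩, hw⟩ := hf
  obtain ⟨A, B, rfl, hA, hB⟩ : ∃ A B, L = A ++ B ∧ Walk P.graph v A w ∧ Walk P.graph w B x := by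
    obtain rfl | ⟨g, hg, hgw⟩ := hw
    · exact ⟨L, [], by simp, hL, Walk.nil _⟩
    · exact hL.exists_split (hC g hg) hgw
  refine ⟨v, hv, A ++ f :: f :: B, walk_append_iff.2 ⟨w, hA, walk_cons_iff.2 ⟨y, hfw,
    walk_cons_iff.2 ⟨w, hfw.symm, hB⟩⟩⟩, fun g hg => ?_, by simp; ring⟩
  obtain rfl | hg := List.mem_cons.1 hg
  · simp
  · have := hC g hg
    simp only [List.mem_append, List.mem_cons] at this ⊢
    tauto

theorem Cover.touch' {f : E} (h : P.Cover n x C k) (hf : P.Touches x C f) :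
    P.Cover n x C (k + 2 * n f) :=
  (h.touch hf).mono fun _ => List.mem_cons_of_mem _

/-- If all edges that touch the list `C` belong to it, then it contains all edges. -/
theorem mem_of_forall_touches (hx : x ∈ P.graph.vertexSet) (h : ∀ f, P.Touches x C f → f ∈ C)
    (f : E) : f ∈ C := by
  obtain ⟨w, hw⟩ := P.exists_inc f
  have key : w = x ∨ ∃ g ∈ C, P.graph.Inc g w := by
    have hxw := P.connected hx hw.vertex_mem
    clear hw
    induction hxw with
    | refl => exact Or.inl rfl
    | tail _ hbc ih =>
      obtain ⟨g, hg⟩ := hbc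
      exact Or.inr ⟨g, h g ⟨_, hg.inc_left, ih⟩, hg.inc_right⟩
  exact h f ⟨w, hw, key⟩

/-- The remaining edges can be ordered so that each of them touches the ones before it. -/
theorem exists_chain [Finite E] (hx : x ∈ P.graph.vertexSet) (C : List E) (hC : C.Nodup) :
    ∃ F : List E, (C ++ F).Nodup ∧ (∀ f, f ∈ C ++ F) ∧
      ∀ A f B, F = A ++ f :: B → P.Touches x (C ++ A) f := by
  classical
  have := Fintype.ofFinite E
  induction hk : Fintype.card E - C.length using Nat.strong_induction_on generalizing C with
  | _ k ih =>
    by_cases hall : ∀ f, f ∈ C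
    · exact ⟨[], by simpa using hC, by simpa using hall, fun A f B h => by simp at h⟩
    · obtain ⟨f, hf, hfC⟩ : ∃ f, P.Touches x C f ∧ f ∉ C := by
        by_contra! h
        exact hall (mem_of_forall_touches hx h)
      have hC' : (C ++ [f]).Nodup := by
        rw [List.nodup_append]
        simp [hC]
        rintro a ha rfl
        exact hfC ha
      have hlen := hC'.length_le_card
      simp at hlen
      obtain ⟨F, hF, hFall, hFt⟩ := ih _ (by simp; omega) (C ++ [f]) hC' rfl
      refine ⟨f :: F, by simpa using hF, by simpa using hFall, fun A g B h => ?_⟩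
      cases A with
      | nil =>
        simp at h
        simpa [← h.1] using hf
      | cons a A =>
        simp at h
        obtain ⟨rfl, rfl⟩ := h
        simpa using hFt A g B rfl

theorem Cover.append_chain (h : P.Cover n x C k) {F : List E}
    (hF : ∀ A f B, F = A ++ f :: B → P.Touches x (C ++ A) f) :
    P.Cover n x (C ++ F) (k + 2 * weight n F) := by
  induction F using List.reverseRecOn with
  | nil => simpa using h
  | append_singleton F f ih =>
    have := (ih fun A g B hA => hF A g (B ++ [f]) (by simp [hA])).touch (hF F f [] rfl)
    have hw : k + 2 * weight n (F ++ [f]) = k + 2 * weight n F + 2 * n f := by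
      simp
      ring
    rw [hw]
    exact this.mono (by simp; tauto)

/-- A vertex that is reached by a walk of length `k` is reached by a walk whose length has the same
parity and that either traverses no edge twice, or traverses the edges of `Q` and `Z` once and
the edges of `M` twice, where the total length of `Z` is odd. -/
theorem Cover.exists_parity (h : P.Cover n x [] k) :
    (∃ O : List E, O.Nodup ∧ P.Cover n x O (weight n O) ∧ weight n O % 2 = k % 2) ∨
    ∃ Q M Z : List E, (Q ++ M ++ Z).Nodup ∧ M ≠ [] ∧ 2 ≤ Z.length ∧ weight n Z % 2 = 1 ∧
      P.Cover n x (Q ++ M ++ Z) (weight n Q + 2 * weight n M + weight n Z) ∧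
      (weight n Q + weight n Z) % 2 = k % 2 ∧ ∀ e ∈ Z, ¬ P.graph.Inc e x := by
  classical
  obtain ⟨v, hv, L, hL, -, rfl⟩ := h
  obtain ⟨L, hL, hpar⟩ := hL.exists_isShortest n
  rw [← hpar]
  by_cases hnd : L.Nodup
  · exact Or.inl ⟨L, hnd, ⟨v, hv, L, hL.1, fun _ => id, rfl⟩, rfl⟩
  obtain ⟨A, B, C, m, rfl, hB⟩ := exists_repeat_of_not_nodup hnd
  obtain ⟨p, q, -, -, hBq, -, -, hodd⟩ := hL.repeat
  have hcount : ∀ e, (A ++ m :: (B ++ m :: C)).count e ≤ 2 := by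
    intro e
    by_contra! hcount
    obtain ⟨A', R, hR, hRc⟩ := exists_eq_append_cons_of_count (k := 2) hcount
    obtain ⟨B', R, rfl, hRc'⟩ := exists_eq_append_cons_of_count (k := 1) hRc
    obtain ⟨C', D, rfl, -⟩ := exists_eq_append_cons_of_count (k := 0) hRc'
    rw [hR] at hL
    exact hL.not_thrice
  obtain ⟨Q, M, hQMZ, hmem, hM, hw⟩ := weight_eq_of_count_le_two n
    (L := A ++ m :: (B ++ m :: C)) hB (fun z hz => by
      obtain ⟨hA, hm, hC⟩ := hL.not_mem_of_mem hz
      simp [List.count_append, List.count_eq_zero_of_not_mem hA,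
        List.count_eq_zero_of_not_mem hC, List.count_eq_one_of_mem hB hz, hm.symm]) hcount
  refine Or.inr ⟨Q, M, B, hQMZ, ?_, ?_, hodd, ⟨v, hv, _, hL.1, fun f hf => (hmem f).1 hf, hw⟩, ?_,
    fun e he => hL.not_inc he⟩
  · refine List.ne_nil_of_mem (a := m) ((hM m).2 (le_antisymm (hcount m) ?_))
    simp
    omega
  -- `B` is closed and odd, hence nonempty, and a single edge would be a loop.
  · match B, hBq, hodd with
    | [], _, hodd => simp at hodd
    | [z], hz, _ =>
      obtain ⟨_, hz, hq⟩ := walk_cons_iff.1 hz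
      exact absurd (walk_nil_iff.1 hq) hz.ne.symm
    | _ :: _ :: _, _, _ => simp
  · omega

end DPSystem

/-! ### Paths with one chord. -/

section ChordedPath

variable {E : Type u}

open Classical in
/-- The first end of an edge of a chorded path. -/
noncomputable def chordSrc (σ : List E) (a : ℕ) (e : E) : ℕ :=
  if σ.idxOf e + 1 = σ.length then a else σ.idxOf e

open Classical in
/-- The second end of an edge of a chorded path. -/
noncomputable def chordTgt (σ : List E) (b : ℕ) (e : E) : ℕ :=
  if σ.idxOf e + 1 = σ.length then b else σ.idxOf e + 1

/-- The graph with edges `σ`, where the edge in position `i` joins the vertices `i` and `i + 1`,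
but the last edge joins `a` and `b`. -/
noncomputable def chordedPathGraph (σ : List E) (a b : ℕ)
    (hab : a < b) (hb : b < σ.length ∨ a + 1 = σ.length ∧ b = σ.length) (hσ : ∀ e, e ∈ σ) :
    Graph ℕ E where
  -- If `b = σ.length`, then `b` is a new vertex and the graph is a plain path; otherwise the last
  -- edge closes a cycle with the path edges from `a` to `b`.
  vertexSet := {j | j < σ.length ∨ j = b}
  IsLink e i j := (i = chordSrc σ a e ∧ j = chordTgt σ b e) ∨
    (i = chordTgt σ b e ∧ j = chordSrc σ a e)
  isLink_symm := fun e _ => ⟨fun i j h => by tauto⟩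
  eq_or_eq_of_isLink_of_isLink := by
    rintro e x y v w (⟨rfl, rfl⟩ | ⟨rfl, rfl⟩) (⟨rfl, rfl⟩ | ⟨rfl, rfl⟩) <;> simp
  left_mem_of_isLink := by
    classical
    intro e x y h
    have := List.idxOf_lt_length_of_mem (hσ e)
    simp only [chordSrc, chordTgt] at h
    simp only [Set.mem_ofPred_eq]
    split_ifs at h <;> omega

variable {σ : List E} {a b : ℕ}
  {hab : a < b} {hb : b < σ.length ∨ a + 1 = σ.length ∧ b = σ.length} {hσ : ∀ e, e ∈ σ}

theorem chordedPathGraph_isLink {e : E} {i j : ℕ}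
    (h : (chordedPathGraph σ a b hab hb hσ).IsLink e i j) :
    (∃ k, σ[k]? = some e ∧ k + 1 < σ.length ∧ (i = k ∧ j = k + 1 ∨ i = k + 1 ∧ j = k)) ∨
    (σ[σ.length - 1]? = some e ∧ (i = a ∧ j = b ∨ i = b ∧ j = a)) := by
  classical
  have hlt := List.idxOf_lt_length_of_mem (hσ e)
  have hget : σ[σ.idxOf e]? = some e := by simp [hσ e]
  simp only [chordedPathGraph, chordSrc, chordTgt] at h
  by_cases hlast : σ.idxOf e + 1 = σ.length
  · right
    simp only [hlast, if_true] at h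
    rw [← hlast]
    simpa [hσ e] using h
  · left
    simp only [hlast, if_false] at h
    exact ⟨_, hget, by omega, h⟩

theorem chordedPathGraph_isLink_of_lt (hnd : σ.Nodup) {e : E} {k : ℕ} (hk : σ[k]? = some e)
    (hlt : k + 1 < σ.length) : (chordedPathGraph σ a b hab hb hσ).IsLink e k (k + 1) := by
  classical
  obtain ⟨hk', rfl⟩ := List.getElem?_eq_some_iff.1 hk
  have : σ.idxOf σ[k] = k := hnd.idxOf_getElem k hk'
  left
  simp [chordSrc, chordTgt, this, hlt.ne]

theorem chordedPathGraph_isLink_last (hnd : σ.Nodup) {e : E}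
    (hk : σ[σ.length - 1]? = some e) : (chordedPathGraph σ a b hab hb hσ).IsLink e a b := by
  classical
  obtain ⟨hk', rfl⟩ := List.getElem?_eq_some_iff.1 hk
  have : σ.idxOf σ[σ.length - 1] = σ.length - 1 := hnd.idxOf_getElem _ hk'
  left
  have : σ.length - 1 + 1 = σ.length := by omega
  simp [chordSrc, chordTgt, *]

theorem chordedPathGraph_isConnected (hnd : σ.Nodup) :
    IsConnected (chordedPathGraph σ a b hab hb hσ) := by
  have h₁ : ∀ j < σ.length,
      Relation.ReflTransGen (chordedPathGraph σ a b hab hb hσ).Adj 0 j := by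
    intro j hj
    induction j with
    | zero => exact .refl
    | succ j ih =>
      exact (ih (by omega)).tail ⟨σ[j], chordedPathGraph_isLink_of_lt hnd (by simp) hj⟩
  have h₂ : ∀ j ∈ (chordedPathGraph σ a b hab hb hσ).vertexSet,
      Relation.ReflTransGen (chordedPathGraph σ a b hab hb hσ).Adj 0 j := by
    intro j hj
    by_cases hj' : j < σ.length
    · exact h₁ j hj'
    · obtain rfl : j = b := hj.resolve_left hj'
      exact (h₁ a (by omega)).tail
        ⟨σ[σ.length - 1]'(by omega), chordedPathGraph_isLink_last hnd (by simp)⟩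
  intro x y hx hy
  exact ((Relation.ReflTransGen.stdSymm (r := (chordedPathGraph σ a b hab hb hσ).Adj)).symm _ _
    (h₂ x hx)).trans (h₂ y hy)

variable (σ a b hab hb hσ) in
/-- The system on a chorded path with one initial point, placed in the vertex `0`. -/
noncomputable def chordedPath (hnd : σ.Nodup) : DPSystem E where
  Vertex := ℕ
  graph := chordedPathGraph σ a b hab hb hσ
  edgeSet_eq := by
    classical
    ext e
    simp only [Set.mem_univ, iff_true]
    exact Graph.IsLink.edge_mem (x := chordSrc σ a e) (y := chordTgt σ b e) (Or.inl ⟨rfl, rfl⟩)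
  loopless := ⟨fun e x h => by
    obtain ⟨k, -, -, h⟩ | ⟨-, h⟩ := chordedPathGraph_isLink h <;> omega⟩
  connected := chordedPathGraph_isConnected hnd
  initial := {0}
  initial_subset := by
    rintro _ rfl
    left
    omega
  initial_nonempty := ⟨0, rfl⟩

theorem chordedPathGraph_degree_le (x : ℕ) :
    degree (chordedPathGraph σ a b hab hb hσ) x ≤ 3 := by
  have hsub : (chordedPathGraph σ a b hab hb hσ).incidenceSet x ⊆
      {e | σ[x]? = some e} ∪ {e | σ[x - 1]? = some e} ∪ {e | σ[σ.length - 1]? = some e} := by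
    rintro e ⟨y, h⟩
    obtain ⟨k, hk, -, ⟨rfl, -⟩ | ⟨rfl, -⟩⟩ | ⟨hk, -⟩ := chordedPathGraph_isLink h
    · exact Or.inl (Or.inl hk)
    · exact Or.inl (Or.inr hk)
    · exact Or.inr hk
  have hone : ∀ o : Option E, {e | o = some e}.encard ≤ 1 := by
    intro o
    rw [Set.encard_le_one_iff]
    rintro e f he hf
    exact Option.some_injective _ (he.symm.trans hf)
  calc _ ≤ _ := Set.encard_le_encard hsub
    _ ≤ 1 + 1 + 1 := (Set.encard_union_le _ _).trans
      (add_le_add ((Set.encard_union_le _ _).trans (add_le_add (hone _) (hone _))) (hone _))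
    _ = 3 := by norm_num

/-- The condition on `a` keeps the chord away from `0`, unless it is the only edge. -/
theorem chordedPathGraph_isTerminal (hnd : σ.Nodup) (ha : 1 ≤ a ∨ σ.length = 1) :
    IsTerminal (chordedPathGraph σ a b hab hb hσ) 0 := by
  have hpos : 0 < σ.length := by omega
  refine ⟨Or.inl hpos, ?_⟩
  have : (chordedPathGraph σ a b hab hb hσ).incidenceSet 0 = {σ[0]} := by
    ext e
    simp only [Graph.mem_incidenceSet, Set.mem_singleton_iff]
    constructor
    · rintro ⟨y, h⟩
      obtain ⟨k, hk, -, ⟨rfl, -⟩ | ⟨h, -⟩⟩ | ⟨hk, h⟩ := chordedPathGraph_isLink h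
      · rw [List.getElem?_eq_getElem hpos] at hk
        simpa using hk.symm
      · omega
      · have h1 : σ.length - 1 = 0 := by omega
        rw [h1, List.getElem?_eq_getElem hpos] at hk
        simpa using hk.symm
    · rintro rfl
      by_cases h1 : σ.length = 1
      · have := chordedPathGraph_isLink_last (hab := hab) (hb := hb) (hσ := hσ) hnd (e := σ[0])
          (by simp [h1])
        obtain rfl : a = 0 := by omega
        exact this.inc_left
      · exact (chordedPathGraph_isLink_of_lt hnd (by simp) (by omega)).inc_left
  rw [degree, this, Set.encard_singleton]

/-- If `c` indicates the edges that cross a cut, then a cycle traverses an even number of them. -/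
theorem IsCycle.sum_cut {V : Type v} {G : Graph V E} {n : ℕ} {x : ℕ → V} {e : ℕ → E}
    (h : IsCycle G n x e) (s : V → ZMod 2) (c : E → ZMod 2)
    (hc : ∀ e x y, G.IsLink e x y → s y - s x = c e) :
    ∑ i ∈ Finset.range n, c (e i) = 0 := by
  rw [← Finset.sum_congr rfl fun i hi => hc _ _ _ (h.link i (Finset.mem_range.1 hi)),
    Finset.sum_range_sub (fun i => s (x i)), h.closed, sub_self]

/-- The cut between the vertices up to `i` and those after it is crossed only by path edge `i` and,
when `a ≤ i < b`, by the chord. Parity then determines the whole edge set of a cycle. -/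
theorem chordedPathGraph_cycle (hnd : σ.Nodup) {n : ℕ} {x : ℕ → ℕ} {e : ℕ → E}
    (h : IsCycle (chordedPathGraph σ a b hab hb hσ) n x e) :
    e '' Set.Iio n = {f | ∃ k, σ[k]? = some f ∧ (a ≤ k ∧ k < b ∨ k + 1 = σ.length)} := by
  classical
  have hpos : 0 < σ.length := by omega
  have hmem : ∀ f, f ∈ (Finset.range n).image e ↔ f ∈ e '' Set.Iio n := by simp
  have hsum : ∀ c : E → ZMod 2,
      ∑ i ∈ Finset.range n, c (e i) = ∑ f ∈ (Finset.range n).image e, c f := by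
    intro c
    rw [Finset.sum_image]
    intro i hi j hj
    exact h.edge_inj (by simpa using hi) (by simpa using hj)
  have key : ∀ i (hi : i + 1 < σ.length),
      (σ[i] ∈ e '' Set.Iio n ↔ (a ≤ i ∧ i < b) ∧ σ[σ.length - 1] ∈ e '' Set.Iio n) := by
    intro i hi
    obtain ⟨c, hc⟩ : ∃ c : E → ZMod 2, c = fun f => (if f = σ[i] then 1 else 0) +
        (if f = σ[σ.length - 1] then (if a ≤ i ∧ i < b then 1 else 0) else 0) := ⟨_, rfl⟩
    have h0 := h.sum_cut (fun v => if i < v then 1 else 0) c (by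
        intro f u w hf
        rw [hc]
        have hne : σ[i] ≠ σ[σ.length - 1] := by
          rw [Ne, hnd.getElem_inj_iff]
          omega
        obtain ⟨k, hk, hlt, huw⟩ | ⟨hk, huw⟩ := chordedPathGraph_isLink hf
        · obtain ⟨hk', rfl⟩ := List.getElem?_eq_some_iff.1 hk
          simp only [hnd.getElem_inj_iff]
          obtain ⟨rfl, rfl⟩ | ⟨rfl, rfl⟩ := huw <;> split_ifs <;> first | omega | decide
        · obtain ⟨hk', rfl⟩ := List.getElem?_eq_some_iff.1 hk
          simp only [hne.symm, if_false, if_true, zero_add]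
          obtain ⟨rfl, rfl⟩ | ⟨rfl, rfl⟩ := huw <;> split_ifs <;> first | omega | decide)
    rw [hsum, hc, Finset.sum_add_distrib, Finset.sum_ite_eq', Finset.sum_ite_eq'] at h0
    simp only [hmem] at h0
    by_cases h1 : σ[i] ∈ e '' Set.Iio n <;>
      by_cases h2 : σ[σ.length - 1] ∈ e '' Set.Iio n <;>
      by_cases h3 : a ≤ i ∧ i < b <;>
      simp only [h1, h2, h3, if_true, if_false, add_zero, zero_add, and_true, and_false,
        and_self] at h0 ⊢ <;>
      exact absurd h0 (by decide)
  -- Some edge is traversed, and a path edge forces the chord by `key`.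
  have hlast : σ[σ.length - 1] ∈ e '' Set.Iio n := by
    have h0 : e 0 ∈ e '' Set.Iio n := ⟨0, h.pos, rfl⟩
    obtain ⟨i, hi, hei⟩ := List.getElem_of_mem (hσ (e 0))
    by_cases hi' : i + 1 < σ.length
    · rw [← hei] at h0
      exact ((key i hi').1 h0).2
    · obtain rfl : i = σ.length - 1 := by omega
      rwa [hei]
  ext f
  obtain ⟨i, hi, rfl⟩ := List.getElem_of_mem (hσ f)
  have hR : (σ[i] ∈ {f | ∃ k, σ[k]? = some f ∧ (a ≤ k ∧ k < b ∨ k + 1 = σ.length)}) ↔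
      (a ≤ i ∧ i < b ∨ i + 1 = σ.length) := by
    constructor
    · rintro ⟨k, hk, h⟩
      obtain ⟨hk', hk⟩ := List.getElem?_eq_some_iff.1 hk
      rwa [← (hnd.getElem_inj_iff).1 hk]
    · exact fun h => ⟨i, by simp, h⟩
  rw [hR]
  by_cases hi' : i + 1 < σ.length
  · rw [key i hi']
    constructor
    · exact fun h => Or.inl h.1
    · rintro (h | h)
      · exact ⟨h, hlast⟩
      · omega
  · obtain rfl : i = σ.length - 1 := by omega
    exact iff_of_true hlast (Or.inr (by omega))

theorem chordedPathGraph_isBead (hnd : σ.Nodup) : IsBead (chordedPathGraph σ a b hab hb hσ) :=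
  fun _ _ _ _ _ _ h h' _ => (chordedPathGraph_cycle hnd h).trans (chordedPathGraph_cycle hnd h').symm

end ChordedPath

/-! ### Bounding walk lengths by a potential. -/

section Potential

variable {E : Type u} {σ : List E} {n : E → ℕ}

/-- The distance between the positions `i` and `j` along the path with edges `σ`. -/
def gap (n : E → ℕ) (σ : List E) (i j : ℕ) : ℕ :=
  -- One of the truncated differences is zero, so the sum is the absolute difference.
  (weight n (σ.take i) - weight n (σ.take j)) + (weight n (σ.take j) - weight n (σ.take i))

theorem weight_take_succ {k : ℕ} {e : E} (h : σ[k]? = some e) :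
    weight n (σ.take (k + 1)) = weight n (σ.take k) + n e := by
  simp [List.take_add_one, h]

theorem weight_take_mono (n : E → ℕ) (σ : List E) {i j : ℕ} (h : i ≤ j) :
    weight n (σ.take i) ≤ weight n (σ.take j) := by
  obtain ⟨d, rfl⟩ := Nat.exists_eq_add_of_le h
  rw [List.take_add, weight_append]
  omega

theorem gap_succ_of_lt {k q : ℕ} {e : E} (h : σ[k]? = some e) (hq : k < q) :
    gap n σ k q = gap n σ (k + 1) q + n e := by
  have h₁ := weight_take_succ (n := n) h
  have h₂ := weight_take_mono n σ (Nat.succ_le_of_lt hq)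
  simp only [gap, Nat.succ_eq_add_one] at *
  omega

theorem gap_succ_of_le {k q : ℕ} {e : E} (h : σ[k]? = some e) (hq : q ≤ k) :
    gap n σ (k + 1) q = gap n σ k q + n e := by
  have h₁ := weight_take_succ (n := n) h
  have h₂ := weight_take_mono n σ hq
  simp only [gap] at *
  omega

/-- The family `B m` of sets of lengths admits detours along the first `m + 1` of the first `R`
edges of `σ`. -/
def Detours (n : E → ℕ) (σ : List E) (R m₀ : ℕ) (B : ℕ → ℕ → Prop) : Prop :=
  -- `m` counts the edges of `σ` available so far; `i = m` is the next edge, which becomes available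
  -- by the detour.
  ∀ m i e k, m₀ ≤ m → i ≤ m → i < R → σ[i]? = some e → B m k →
    ∃ m' ≥ m, i + 1 ≤ m' ∧ B m' (k + 2 * n e)

variable {R m₀ : ℕ} {B : ℕ → ℕ → Prop}

/-- The potential is the elapsed length `t` plus the straight way to `q` plus a constant. A step
towards `q` preserves it; a step away raises it by `2 * n e`, which is a detour. -/
theorem Detours.up (hB : Detours n σ R m₀ B) {m j q t s : ℕ} {e : E} (hm : m₀ ≤ m) (hj : j ≤ m)
    (hq : q ≤ m₀) (hjR : j < R) (he : σ[j]? = some e) (h : B m (t + gap n σ j q + s)) :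
    ∃ m' ≥ m, j + 1 ≤ m' ∧ B m' (t + n e + gap n σ (j + 1) q + s) := by
  by_cases hjq : j < q
  · refine ⟨m, le_rfl, by omega, ?_⟩
    rw [gap_succ_of_lt he hjq] at h
    convert h using 1
    ring
  · obtain ⟨m', hm', hj', h'⟩ := hB m j e _ hm hj hjR he h
    refine ⟨m', hm', hj', ?_⟩
    rw [gap_succ_of_le he (not_lt.1 hjq)]
    convert h' using 1
    ring

theorem Detours.down (hB : Detours n σ R m₀ B) {m j q t s : ℕ} {e : E} (hm : m₀ ≤ m)
    (hj : j + 1 ≤ m) (hjR : j < R) (he : σ[j]? = some e)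
    (h : B m (t + gap n σ (j + 1) q + s)) :
    ∃ m' ≥ m, B m' (t + n e + gap n σ j q + s) := by
  by_cases hjq : j < q
  · obtain ⟨m', hm', -, h'⟩ := hB m j e _ hm (by omega) hjR he h
    refine ⟨m', hm', ?_⟩
    rw [gap_succ_of_lt he hjq]
    convert h' using 1
    ring
  · refine ⟨m, le_rfl, ?_⟩
    rw [gap_succ_of_le he (not_lt.1 hjq)] at h
    convert h using 1
    ring

variable {a b : ℕ}
  {hab : a < b} {hb : b < σ.length ∨ a + 1 = σ.length ∧ b = σ.length} {hσ : ∀ e, e ∈ σ}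

/-- The lengths of the walks on a path from the first vertex to the vertex `p`. -/
theorem walk_path_bound (hbσ : b = σ.length) {p : ℕ} (hB : Detours n σ σ.length p B)
    (h₀ : B p (weight n (σ.take p))) {L : List E}
    (hL : Walk (chordedPathGraph σ a b hab hb hσ) 0 L p) : ∃ m, B m (weight n L) := by
  have key : ∀ {i L j}, Walk (chordedPathGraph σ a b hab hb hσ) i L j → ∀ t m, p ≤ m → i ≤ m →
      B m (t + gap n σ i p + 0) → ∃ m', B m' (t + weight n L + gap n σ j p + 0) := by
    intro i L j hL
    induction hL with
    | nil i => exact fun t m _ _ h => ⟨m, h⟩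
    | @cons i j z e L hl _ ih =>
      intro t m hpm him h
      obtain ⟨k, hk, hkl, hij⟩ : ∃ k, σ[k]? = some e ∧ k < σ.length ∧
          (i = k ∧ j = k + 1 ∨ i = k + 1 ∧ j = k) := by
        obtain ⟨k, hk, hkl, hij⟩ | ⟨hk, hij⟩ := chordedPathGraph_isLink hl
        · exact ⟨k, hk, by omega, hij⟩
        · exact ⟨_, hk, by omega, by omega⟩
      rw [weight_cons, ← add_assoc]
      obtain ⟨rfl, rfl⟩ | ⟨rfl, rfl⟩ := hij
      · obtain ⟨m', hm', hk', h'⟩ := hB.up hpm him le_rfl hkl hk h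
        exact ih _ m' (by omega) hk' h'
      · obtain ⟨m', hm', h'⟩ := hB.down hpm him hkl hk h
        exact ih _ m' (by omega) (by omega) h'
  obtain ⟨m', h⟩ := key hL 0 p le_rfl (Nat.zero_le _) (by simpa [gap] using h₀)
  exact ⟨m', by simpa [gap] using h⟩

/-- The lengths of the walks on a path with a chord from the first vertex to a vertex `p` before
the chord. -/
theorem walk_chord_bound (hbσ : b < σ.length) {p : ℕ} (hpa : p ≤ a) {c : E}
    (hc : σ[σ.length - 1]? = some c) (hB : Detours n σ (σ.length - 1) b B)
    (hBc : ∀ m k, B m k → B m (k + 2 * n c))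
    (h₀ : B b (gap n σ 0 b + (n c + gap n σ a p))) {L : List E}
    (hL : Walk (chordedPathGraph σ a b hab hb hσ) 0 L p) :
    ∃ m, B m (weight n L) ∨ B m (weight n L + gap n σ p b + (n c + gap n σ a p)) := by
  have hDa := weight_take_mono n σ hpa
  have hDb := weight_take_mono n σ hab.le
  -- The walk so far is completed either straight to `p` or through `b`, the chord and `a`. Path
  -- steps keep the alternative; the chord switches it, raising the potential by `0` or `2 * n c`.
  have key : ∀ {i L j}, Walk (chordedPathGraph σ a b hab hb hσ) i L j → ∀ t m, b ≤ m → i ≤ m →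
      (B m (t + gap n σ i p + 0) ∨ B m (t + gap n σ i b + (n c + gap n σ a p))) →
      ∃ m', (B m' (t + weight n L + gap n σ j p + 0) ∨
        B m' (t + weight n L + gap n σ j b + (n c + gap n σ a p))) := by
    intro i L j hL
    induction hL with
    | nil i => exact fun t m _ _ h => ⟨m, h⟩
    | @cons i j z e L hl _ ih =>
      intro t m hbm him h
      rw [weight_cons, ← add_assoc]
      obtain ⟨k, hk, hkl, ⟨rfl, rfl⟩ | ⟨rfl, rfl⟩⟩ | ⟨hk, hij⟩ := chordedPathGraph_isLink hl
      · obtain h | h := h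
        · obtain ⟨m', hm', hk', h'⟩ := hB.up hbm him (by omega) (by omega) hk h
          exact ih _ m' (by omega) hk' (Or.inl h')
        · obtain ⟨m', hm', hk', h'⟩ := hB.up hbm him le_rfl (by omega) hk h
          exact ih _ m' (by omega) hk' (Or.inr h')
      · obtain h | h := h
        · obtain ⟨m', hm', h'⟩ := hB.down hbm him (by omega) hk h
          exact ih _ m' (by omega) (by omega) (Or.inl h')
        · obtain ⟨m', hm', h'⟩ := hB.down hbm him (by omega) hk h
          exact ih _ m' (by omega) (by omega) (Or.inr h')
      · obtain rfl : c = e := Option.some_injective _ (hc.symm.trans hk)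
        obtain ⟨rfl, rfl⟩ | ⟨rfl, rfl⟩ := hij
        · refine ih _ m hbm hbm ?_
          obtain h | h := h
          · refine Or.inr ?_
            convert hBc _ _ h using 1
            simp only [gap]
            omega
          · refine Or.inl ?_
            convert h using 1
            simp only [gap]
            omega
        · refine ih _ m hbm (by omega) ?_
          obtain h | h := h
          · refine Or.inr ?_
            convert hBc _ _ h using 1
            simp only [gap]
            omega
          · refine Or.inl ?_
            convert h using 1
            simp only [gap]
            omega
  -- The start is in the second alternative: `h₀` is the length of the route round the cycle.
  obtain ⟨m', h⟩ := key hL 0 b le_rfl (Nat.zero_le _) (Or.inr (by simpa using h₀))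
  exact ⟨m', by simpa [gap] using h⟩

end Potential

/-! ### Rearranging a system into a path or a path with a chord. -/

section Construction

variable {E : Type u} {σ : List E} {n : E → ℕ} {a b : ℕ}
  {hab : a < b} {hb : b < σ.length ∨ a + 1 = σ.length ∧ b = σ.length} {hσ : ∀ e, e ∈ σ}

theorem walk_segment (hnd : σ.Nodup) {i j : ℕ} (hij : i ≤ j) (hj : j < σ.length) :
    Walk (chordedPathGraph σ a b hab hb hσ) i ((σ.take j).drop i) j := by
  induction j, hij using Nat.le_induction with
  | base =>
    rw [List.drop_eq_nil_of_le (by simp)]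
    exact Walk.nil _
  | succ j hij ih =>
    rw [List.take_add_one, List.getElem?_eq_getElem (by omega), List.drop_append_of_le_length
      (by simp; omega), walk_append_iff]
    exact ⟨j, ih (by omega), walk_cons_iff.2
      ⟨_, chordedPathGraph_isLink_of_lt hnd (by simp) hj, Walk.nil _⟩⟩

theorem path_isLink (hnd : σ.Nodup) (hbσ : b = σ.length) {k : ℕ} {e : E} (hk : σ[k]? = some e) :
    (chordedPathGraph σ a b hab hb hσ).IsLink e k (k + 1) := by
  have hlt := (List.getElem?_eq_some_iff.1 hk).1
  by_cases h : k + 1 < σ.length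
  · exact chordedPathGraph_isLink_of_lt hnd hk h
  · obtain rfl : k = σ.length - 1 := by omega
    have := chordedPathGraph_isLink_last (hab := hab) (hb := hb) (hσ := hσ) hnd hk
    convert this using 1 <;> omega

theorem walk_path_take (hnd : σ.Nodup) (hbσ : b = σ.length) {j : ℕ} (hj : j ≤ σ.length) :
    Walk (chordedPathGraph σ a b hab hb hσ) 0 (σ.take j) j := by
  induction j with
  | zero => exact Walk.nil _
  | succ j ih =>
    rw [List.take_add_one, List.getElem?_eq_getElem (by omega), walk_append_iff]
    exact ⟨j, ih (by omega), walk_cons_iff.2 ⟨_, path_isLink hnd hbσ (by simp), Walk.nil _⟩⟩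

/-- The systems whose graph is a bead graph with degrees at most three and that have one initial
point, placed in a terminal vertex. -/
def IsTerminalBead (P : DPSystem E) : Prop :=
  IsBead P.graph ∧ (∀ x ∈ P.graph.vertexSet, degree P.graph x ≤ 3) ∧
    ∃ x₀ : P.Vertex, P.initial = {x₀} ∧ IsTerminal P.graph x₀

theorem chordedPath_isTerminalBead (hnd : σ.Nodup) (ha : 1 ≤ a ∨ σ.length = 1) :
    IsTerminalBead (chordedPath σ a b hab hb hσ hnd) :=
  ⟨chordedPathGraph_isBead (hab := hab) (hb := hb) (hσ := hσ) hnd,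
    fun x _ => chordedPathGraph_degree_le (hab := hab) (hb := hb) (hσ := hσ) x, (0 : ℕ), rfl,
    chordedPathGraph_isTerminal (hab := hab) (hb := hb) (hσ := hσ) hnd ha⟩

theorem chordedPath_cover_iff (hnd : σ.Nodup) {p k : ℕ} :
    (chordedPath σ a b hab hb hσ hnd).Cover n p [] k ↔
      ∃ L, Walk (chordedPathGraph σ a b hab hb hσ) 0 L p ∧ weight n L = k := by
  constructor
  · rintro ⟨_, rfl, L, hL, -, hk⟩
    exact ⟨L, hL, hk⟩
  · rintro ⟨L, hL, hk⟩
    exact ⟨(0 : ℕ), rfl, L, hL, by simp, hk⟩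

variable {P : DPSystem E} {x : P.Vertex}

/-- An edge already traversed can be repeated back and forth, and the next edge of `F` touches an
earlier one. Both add an even length, so the residue `r` persists. `X` holds traversed edges listed
separately, which will be the chord. -/
theorem detours_of_chain {X C F Y : List E} {r : ℕ}
    (hF : ∀ A f B, F = A ++ f :: B → P.Touches x (X ++ C ++ A) f) :
    Detours n (C ++ F ++ Y) (C.length + F.length) C.length
      (fun m k => P.Cover n x (X ++ (C ++ F ++ Y).take m) k ∧ k % 2 = r) := by
  rintro m i e k hm him hiR hi ⟨hk, hr⟩
  by_cases hlt : i < m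
  · refine ⟨m, le_rfl, hlt, hk.touch' (DPSystem.touches_of_mem ?_), by omega⟩
    refine List.mem_append_right _ (List.mem_of_getElem? (i := i) ?_)
    rw [List.getElem?_take_of_lt hlt, hi]
  · obtain rfl : i = m := by omega
    refine ⟨i + 1, by omega, le_rfl, ?_, by omega⟩
    have hiF : F[i - C.length]? = some e := by
      rwa [List.getElem?_append_left (by simpa using hiR), List.getElem?_append_right hm] at hi
    obtain ⟨hlt', hget⟩ := List.getElem?_eq_some_iff.1 hiF
    have htake : (C ++ F ++ Y).take i = C ++ F.take (i - C.length) := by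
      rw [List.take_append_of_le_length (by simp; omega), List.take_append,
        List.take_of_length_le hm]
    have hsplit : F = F.take (i - C.length) ++ e :: F.drop (i - C.length + 1) := by
      rw [← hget, ← List.drop_eq_getElem_cons, List.take_append_drop]
    have ht := hF _ _ _ hsplit
    rw [htake] at hk
    rw [List.append_assoc] at ht
    refine (hk.touch ht).mono fun f hf => ?_
    rw [List.take_add_one, hi, htake] at hf
    simp at hf ⊢
    tauto

/-- A system whose graph is a path, if the vertex `x` is reached by a walk that traverses no edge
twice. -/
theorem exists_path [Finite E] {e : E} (he : P.graph.Inc e x) {O : List E} (hO : O.Nodup)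
    (hcov : P.Cover n x O (weight n O)) :
    ∃ P' : DPSystem E, IsTerminalBead P' ∧ ∃ x', P'.graph.Inc e x' ∧
      P'.Cover n x' [] (weight n O) ∧ ∀ k, P'.Cover n x' [] k → P.Cover n x [] k := by
  classical
  -- The order of `O` is free, so `e` is put last in `C`, or first in `F` if it is not traversed;
  -- either way it ends at vertex `C.length`.
  obtain ⟨C, F, hnd, hall, hmem, hw, hpos, hF⟩ : ∃ C F : List E, (C ++ F).Nodup ∧
      (∀ f, f ∈ C ++ F) ∧ (∀ f, f ∈ C ↔ f ∈ O) ∧ weight n C = weight n O ∧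
      ((C ++ F)[C.length]? = some e ∨ ∃ k, k + 1 = C.length ∧ (C ++ F)[k]? = some e) ∧
      ∀ A f B, F = A ++ f :: B → P.Touches x (C ++ A) f := by
    by_cases heO : e ∈ O
    · have hp : O.Perm (O.erase e ++ [e]) :=
        (List.perm_cons_erase heO).trans (List.perm_append_singleton e _).symm
      obtain ⟨F, hnd, hall, hF⟩ := DPSystem.exists_chain he.vertex_mem _ (hp.nodup_iff.1 hO)
      exact ⟨O.erase e ++ [e], F, hnd, hall, fun f => hp.mem_iff.symm, (Perm.weight_eq hp).symm,
        Or.inr ⟨(O.erase e).length, by simp, by simp⟩, hF⟩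
    · have hO' : (O ++ [e]).Nodup := by
        rw [(List.perm_append_singleton e O).nodup_iff]
        exact List.nodup_cons.2 ⟨heO, hO⟩
      obtain ⟨F, hnd, hall, hF⟩ := DPSystem.exists_chain he.vertex_mem _ hO'
      refine ⟨O, e :: F, by simpa using hnd, by simpa using hall, fun f => Iff.rfl, rfl,
        Or.inl (by simp), fun A g B h => ?_⟩
      cases A with
      | nil =>
        simp at h
        exact ⟨x, h.1 ▸ he, Or.inl rfl⟩
      | cons a A =>
        simp at h
        obtain ⟨rfl, rfl⟩ := h
        simpa using hF A g B rfl
  have hN : 0 < (C ++ F).length := List.length_pos_of_mem (hall e)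
  have hab : (C ++ F).length - 1 < (C ++ F).length := by omega
  have hb : (C ++ F).length < (C ++ F).length ∨
    (C ++ F).length - 1 + 1 = (C ++ F).length ∧ (C ++ F).length = (C ++ F).length := by omega
  refine ⟨chordedPath (C ++ F) _ _ hab hb hall hnd,
    chordedPath_isTerminalBead hnd (by omega), C.length, ?_, ?_, ?_⟩
  · obtain h | ⟨k, hk, h⟩ := hpos
    · exact (path_isLink (hab := hab) (hb := hb) (hσ := hall) hnd rfl h).inc_left
    · rw [← hk]
      exact (path_isLink (hab := hab) (hb := hb) (hσ := hall) hnd rfl h).inc_right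
  · rw [chordedPath_cover_iff]
    exact ⟨_, walk_path_take hnd rfl (by simp), by simp [hw]⟩
  · intro k hk
    rw [chordedPath_cover_iff] at hk
    obtain ⟨L, hL, rfl⟩ := hk
    have hd := detours_of_chain (n := n) (P := P) (x := x) (X := []) (C := C) (F := F) (Y := [])
      (r := weight n O % 2) (by simpa using hF)
    rw [List.append_nil, ← List.length_append] at hd
    obtain ⟨m, hm, -⟩ := walk_path_bound rfl hd (by
      rw [List.take_left', hw]
      exact ⟨hcov.mono (by simpa using fun f => (hmem f).1), rfl⟩; rfl) hL
    exact hm.mono (by simp)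

/-- A system whose graph is a path with one chord, if a walk of the given parity has to traverse a
cycle. -/
theorem exists_chord [Finite E] {e : E} (he : P.graph.Inc e x) {Q M Z : List E}
    (hnd : (Q ++ M ++ Z).Nodup) (hM : M ≠ []) (hZ : 2 ≤ Z.length) (hodd : weight n Z % 2 = 1)
    (hcov : P.Cover n x (Q ++ M ++ Z) (weight n Q + 2 * weight n M + weight n Z)) (heZ : e ∉ Z) :
    ∃ P' : DPSystem E, IsTerminalBead P' ∧ ∃ x', P'.graph.Inc e x' ∧
      (∃ k, P'.Cover n x' [] k ∧ k % 2 = (weight n Q + weight n Z) % 2) ∧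
      ∀ k, k % 2 = (weight n Q + weight n Z) % 2 → P'.Cover n x' [] k → P.Cover n x [] k := by
  classical
  -- Reordering makes `e` end at vertex `Q.length`. If `e` is not traversed, a detour along it adds
  -- it to `M` without changing the parity.
  wlog heQM : (∃ A, Q = A ++ [e]) ∨ ∃ A, M = e :: A generalizing Q M with H
  · by_cases heQ : e ∈ Q
    · have hp : Q.Perm (Q.erase e ++ [e]) :=
        (List.perm_cons_erase heQ).trans (List.perm_append_singleton e _).symm
      have hp' := (hp.append_right M).append_right Z
      rw [Perm.weight_eq hp] at hcov ⊢
      exact H (hp'.nodup_iff.1 hnd) hM (hcov.mono fun f => hp'.mem_iff.2) (Or.inl ⟨_, rfl⟩)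
    by_cases heM : e ∈ M
    · have hp : M.Perm (e :: M.erase e) := List.perm_cons_erase heM
      have hp' := (hp.append_left Q).append_right Z
      rw [Perm.weight_eq hp] at hcov
      exact H (hp'.nodup_iff.1 hnd) (by simp) (hcov.mono fun f => hp'.mem_iff.2) (Or.inr ⟨_, rfl⟩)
    · have hp : (Q ++ e :: M ++ Z).Perm (e :: (Q ++ M ++ Z)) := by simp
      have hcov' := (hcov.touch ⟨x, he, Or.inl rfl⟩).mono fun f => hp.mem_iff.1
      exact H (M := e :: M)
        (hp.nodup_iff.2 (List.nodup_cons.2 ⟨by simp [heQ, heM, heZ], hnd⟩)) (List.cons_ne_nil _ _)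
        (by
          convert hcov' using 1
          rw [weight_cons]
          ring) (Or.inr ⟨_, rfl⟩)
  -- The last edge of `Z` becomes the chord, the others stay on the path.
  obtain ⟨Z, c, rfl⟩ : ∃ Z' c, Z = Z' ++ [c] :=
    ⟨Z.dropLast, Z.getLast (by rintro rfl; simp at hZ),
      (List.dropLast_append_getLast _).symm⟩
  obtain ⟨F, hndF, hall, hF⟩ := DPSystem.exists_chain he.vertex_mem (c :: (Q ++ M ++ Z)) (by
    refine (List.Perm.nodup_iff ?_).1 hnd
    rw [← List.append_assoc]
    exact List.perm_append_singleton c _)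
  set C := Q ++ M ++ Z with hC
  have hndσ : (C ++ F ++ [c]).Nodup := by
    refine (List.Perm.nodup_iff ?_).1 hndF
    exact (List.perm_append_singleton c _).symm
  have hσ : ∀ f, f ∈ C ++ F ++ [c] := by
    intro f
    have := hall f
    simp at this ⊢
    tauto
  have hlenM := List.length_pos_of_ne_nil hM
  simp at hZ
  have hlen : (C ++ F ++ [c]).length = Q.length + M.length + Z.length + F.length + 1 := by
    simp [hC]
    omega
  have hCl : C.length = Q.length + M.length + Z.length := by
    simp [hC]
    omega
  have hab : Q.length + M.length < C.length := by omega
  have hb : C.length < (C ++ F ++ [c]).length := by omega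
  have hc : (C ++ F ++ [c])[(C ++ F ++ [c]).length - 1]? = some c := by simp
  have hQt : (C ++ F ++ [c]).take Q.length = Q := by simp [hC]
  have hMt : (C ++ F ++ [c]).take (Q.length + M.length) = Q ++ M := by
    simp [hC, List.take_append]
  have hCt : (C ++ F ++ [c]).take C.length = C := by simp
  refine ⟨chordedPath (C ++ F ++ [c]) _ _ hab (Or.inl hb) hσ hndσ,
    chordedPath_isTerminalBead hndσ (by omega), Q.length, ?_, ?_, ?_⟩
  · obtain ⟨A, hA⟩ | ⟨A, hA⟩ := heQM
    · have := chordedPathGraph_isLink_of_lt (hab := hab) (hb := Or.inl hb) (hσ := hσ) hndσ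
        (k := A.length) (e := e) (by simp [hC, hA]) (by rw [hlen, hA]; simp; omega)
      have hQ : A.length + 1 = Q.length := by simp [hA]
      rw [hQ] at this
      exact this.inc_right
    · exact (chordedPathGraph_isLink_of_lt (hab := hab) (hb := Or.inl hb) (hσ := hσ) hndσ
        (k := Q.length) (e := e) (by simp [hC, hA]) (by rw [hlen, hA]; simp; omega)).inc_left
  · simp only [chordedPath_cover_iff]
    have h₁ := walk_segment (hab := hab) (hb := Or.inl hb) (hσ := hσ) hndσ (Nat.zero_le C.length) hb
    have h₂ := walk_segment (hab := hab) (hb := Or.inl hb) (hσ := hσ) hndσ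
      (Nat.le_add_right Q.length M.length) (hab.trans hb)
    have h₃ := chordedPathGraph_isLink_last (hab := hab) (hb := Or.inl hb) (hσ := hσ) hndσ hc
    rw [hCt, List.drop_zero] at h₁
    rw [hMt, List.drop_left'] at h₂
    -- Along the stem, once round the cycle, and back along `M`.
    refine ⟨_, ⟨C ++ c :: M.reverse,
      walk_append_iff.2 ⟨_, h₁, walk_cons_iff.2 ⟨_, h₃.symm, h₂.reverse⟩⟩, rfl⟩, ?_⟩
    · simp [hC]
      omega
    · rfl
  · intro k hpar hk
    rw [chordedPath_cover_iff] at hk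
    obtain ⟨L, hL, rfl⟩ := hk
    have hd := detours_of_chain (n := n) (P := P) (x := x) (X := [c]) (C := C) (F := F) (Y := [c])
      (r := (weight n Q + weight n (Z ++ [c])) % 2) (by simpa using hF)
    have hR : C.length + F.length = (C ++ F ++ [c]).length - 1 := by simp
    rw [hR] at hd
    have hga : gap n (C ++ F ++ [c]) (Q.length + M.length) Q.length = weight n M := by
      rw [gap, hQt, hMt, weight_append]
      omega
    obtain ⟨m, ⟨hm, -⟩ | ⟨-, hm⟩⟩ := walk_chord_bound hb (Nat.le_add_right _ _) hc hd
      (fun m k hk => ⟨hk.1.touch' (DPSystem.touches_of_mem (by simp)), by omega⟩) (by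
        rw [hga, hCt]
        have : gap n (C ++ F ++ [c]) 0 C.length + (n c + weight n M) =
            weight n Q + 2 * weight n M + weight n (Z ++ [c]) := by
          simp only [gap, hCt]
          simp [hC]
          ring
        rw [this]
        exact ⟨hcov.mono (by simp [hC]; tauto), by omega⟩) hL
    · exact hm.mono (by simp)
    -- The second alternative exceeds the length of `L` by twice `M` plus the odd cycle, so it has
    -- the wrong parity.
    · exfalso
      rw [hga] at hm
      have : gap n (C ++ F ++ [c]) Q.length C.length = weight n M + weight n Z := by
        simp only [gap, hCt, hQt]
        simp [hC]
      rw [this] at hm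
      simp at hodd hm hpar
      omega

/-- Every vertex of a system can be imitated by a vertex of a system with one initial point in a
terminal vertex of a bead graph, as far as walks of one parity are concerned. -/
theorem exists_isTerminalBead [Finite E] {e : E} (he : P.graph.Inc e x) {u : ℕ}
    (hu : P.Cover n x [] u) :
    ∃ P' : DPSystem E, IsTerminalBead P' ∧ ∃ x', P'.graph.Inc e x' ∧
      (∃ k, P'.Cover n x' [] k ∧ k % 2 = u % 2) ∧
      ∀ k, k % 2 = u % 2 → P'.Cover n x' [] k → P.Cover n x [] k := by
  obtain ⟨O, hO, hcov, hpar⟩ | ⟨Q, M, Z, hnd, hM, hZ, hodd, hcov, hpar, heZ⟩ := hu.exists_parity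
  · obtain ⟨P', hP', x', hx', hk, h⟩ := exists_path he hO hcov
    exact ⟨P', hP', x', hx', ⟨_, hk, hpar⟩, fun k _ => h k⟩
  · obtain ⟨P', hP', x', hx', ⟨k, hk, hkp⟩, h⟩ := exists_chord he hnd hM hZ hodd hcov fun hz => heZ e hz he
    exact ⟨P', hP', x', hx', ⟨k, hk, hkp.trans hpar⟩, fun k hk => h k (hk.trans hpar.symm)⟩

end Construction

/-! ### Instabilities and the count at integer times. -/

section Dynamics

variable {E : Type u} {n : E → ℕ} {P : DPSystem E} {x : P.Vertex}

theorem Walk.right_mem {V : Type v} {G : Graph V E} {x y : V} {L : List E} (h : Walk G x L y)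
    (hx : x ∈ G.vertexSet) : y ∈ G.vertexSet := by
  induction h with
  | nil => exact hx
  | cons h _ ih => exact ih h.right_mem

theorem cover_link {y : P.Vertex} {e : E} {k : ℕ} (h : P.Cover n x [] k)
    (he : P.graph.IsLink e x y) : P.Cover n y [] (k + n e) := by
  obtain ⟨v, hv, L, hL, -, rfl⟩ := h
  exact ⟨v, hv, L ++ [e], walk_append_iff.2 ⟨x, hL, walk_cons_iff.2 ⟨y, he, Walk.nil y⟩⟩, by simp,
    by simp⟩

/-- From some time on, uniformly in the system, a vertex that has been reached at some time is
reached at all times of the same parity. -/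
theorem exists_forall_cover [Finite E] (hn : Nat.setGcd (Set.range n) = 1) :
    ∃ B, ∀ (P : DPSystem E) (x : P.Vertex) (u k : ℕ), P.Cover n x [] u → B ≤ k → k % 2 = u % 2 →
      P.Cover n x [] k := by
  have := Fintype.ofFinite E
  obtain ⟨B, hB⟩ := Nat.exists_mem_closure_of_ge (Set.range n)
  rw [hn] at hB
  -- `2 * ∑ e, n e` bounds the base walk and again the detours through the edges it omits; `2 * B`
  -- leaves a remainder whose half is a sum of lengths.
  refine ⟨4 * ∑ e, n e + 2 * B, fun P x u k hu hk hpar => ?_⟩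
  have hx : x ∈ P.graph.vertexSet := by
    obtain ⟨v, hv, L, hL, -⟩ := hu
    exact hL.right_mem (P.initial_subset hv)
  obtain ⟨C, hC, c, hcov, hcpar, hc⟩ : ∃ C : List E, C.Nodup ∧ ∃ c, P.Cover n x C c ∧
      c % 2 = u % 2 ∧ c ≤ 2 * ∑ e, n e := by
    obtain ⟨O, hO, hcov, hpar⟩ | ⟨Q, M, Z, hnd, -, -, -, hcov, hpar, -⟩ := hu.exists_parity
    · have := weight_le_sum n hO
      exact ⟨O, hO, _, hcov, hpar, by omega⟩
    · have := weight_le_sum n hnd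
      rw [weight_append, weight_append] at this
      exact ⟨_, hnd, _, hcov, by omega, by omega⟩
  obtain ⟨F, hndF, hall, hF⟩ := DPSystem.exists_chain hx C hC
  have hcovF := hcov.append_chain hF
  have hFle := weight_le_sum n hndF
  rw [weight_append] at hFle
  have key : ∀ s ∈ AddSubmonoid.closure (Set.range n), ∀ c, P.Cover n x (C ++ F) c →
      P.Cover n x (C ++ F) (c + 2 * s) := by
    intro s hs
    induction hs using AddSubmonoid.closure_induction with
    | mem s hs =>
      obtain ⟨e, rfl⟩ := hs
      exact fun c hc => hc.touch' (DPSystem.touches_of_mem (hall e))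
    | zero => exact fun c hc => hc
    | add s t _ _ hs ht =>
      intro c hc
      rw [mul_add, ← add_assoc]
      exact ht _ (hs c hc)
  have hsum := key ((k - (c + 2 * weight n F)) / 2) (hB _ (by omega) (one_dvd _)) _ hcovF
  have hk' : c + 2 * weight n F + 2 * ((k - (c + 2 * weight n F)) / 2) = k := by omega
  rw [hk'] at hsum
  exact hsum.mono (by simp)

/-- At time `k` some point is produced on an edge `e` in an end of it that no point reaches along
`e` at this time. -/
def Unstable (P : DPSystem E) (n : E → ℕ) (k : ℕ) : Prop :=
  ∃ x y e, P.graph.IsLink e x y ∧ P.Cover n y [] k ∧ ∀ j, P.Cover n x [] j → j + n e ≠ k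

/-- This makes the set of unstable times nonempty, with maximum `0` when the count never changes. -/
theorem unstable_zero (hn : ∀ e, 0 < n e) [Nonempty E] (P : DPSystem E) : Unstable P n 0 := by
  obtain ⟨y, hy⟩ := P.initial_nonempty
  obtain ⟨e, he⟩ : ∃ e, P.graph.Inc e y := by
    obtain ⟨e⟩ := ‹Nonempty E›
    by_contra! h
    have := DPSystem.mem_of_forall_touches (C := []) (P.initial_subset hy)
      (fun f ⟨w, hf, hw⟩ => by
        obtain rfl | ⟨g, hg, -⟩ := hw
        · exact absurd hf (h f)
        · simp at hg) e
    simp at this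
  obtain ⟨x, hx⟩ := he
  refine ⟨x, y, e, hx.symm, ⟨y, hy, [], Walk.nil y, by simp, rfl⟩, fun j _ => ?_⟩
  have := hn e
  omega

/-- If `y` is occupied at `k`, then `x` is occupied at `k + n e`, hence for large `k` also at `k - n
e`, which has the same parity. -/
theorem exists_unstable_le [Finite E] (hn : Nat.setGcd (Set.range n) = 1) :
    ∃ B, ∀ (P : DPSystem E) (k : ℕ), Unstable P n k → k ≤ B := by
  have := Fintype.ofFinite E
  obtain ⟨B, hB⟩ := exists_forall_cover hn
  refine ⟨B + ∑ e, n e, fun P k ⟨x, y, e, he, hy, h⟩ => ?_⟩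
  have hle : n e ≤ ∑ e, n e := Finset.single_le_sum (by simp) (Finset.mem_univ e)
  by_contra! hk
  exact h (k - n e) (hB P x _ _ (cover_link hy he.symm) (by omega) (by omega)) (by omega)

theorem exists_isTerminalBead_unstable [Finite E] (hn : Nat.setGcd (Set.range n) = 1)
    (hpos : ∀ e, 0 < n e) {K : ℕ} (h : Unstable P n K) :
    ∃ P' : DPSystem E, IsTerminalBead P' ∧ ∃ k ≥ K, Unstable P' n k := by
  classical
  obtain ⟨x, y, e, he, hy, hx⟩ := h
  obtain ⟨P', hP', x', ⟨y', he'⟩, ⟨c, hc, hcpar⟩, hsub⟩ :=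
    exists_isTerminalBead he.inc_left (cover_link hy he.symm)
  refine ⟨P', hP', ?_⟩
  have hpe := hpos e
  -- `k` is the first time occupied at `x'` among `K + n e + 2 * (n e * i)`. For `i = 0` the
  -- preceding time is `K - n e`, which is excluded by the instability in `P`.
  obtain ⟨k, hk, hkcov, hkno⟩ : ∃ k ≥ K + n e, P'.Cover n x' [] k ∧
      ∀ j, P'.Cover n x' [] j → j + 2 * n e ≠ k := by
    obtain ⟨B, hB⟩ := exists_forall_cover hn
    have hex : ∃ i, P'.Cover n x' [] (K + n e + 2 * (n e * i)) :=
      ⟨B, hB P' x' _ _ hc (by nlinarith) (by omega)⟩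
    refine ⟨_, Nat.le_add_right _ _, Nat.find_spec hex, fun j hj hjk => ?_⟩
    rcases hi : Nat.find hex with _ | i
    · rw [hi] at hjk
      exact hx j (hsub j (by omega) hj) (by omega)
    · refine Nat.find_min hex (m := i) (by omega) ?_
      rw [hi, mul_add] at hjk
      convert hj using 1
      omega
  -- A return trip of `x'` along `e` ending at `k` fails at one of its two halves: at time `k - n e`
  -- in `y'`, or at time `k` in `x'`.
  by_cases hy' : P'.Cover n y' [] (k - n e)
  · exact ⟨k - n e, by omega, x', y', e, he', hy', fun j hj hjk => hkno j hj (by omega)⟩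
  · refine ⟨k, by omega, y', x', e, he'.symm, hkcov, fun j hj hjk => hy' ?_⟩
    rwa [← hjk, Nat.add_sub_cancel]

/-- The points at time `k`, if all lengths are integers. -/
def intPoints (P : DPSystem E) (n : E → ℕ) (k : ℕ) : Set (E × P.Vertex × ℕ) :=
  {p | P.graph.Inc p.1 p.2.1 ∧ P.Cover n p.2.1 [] p.2.2 ∧ p.2.2 ≤ k ∧ k < p.2.2 + n p.1}

theorem intPoints_finite [Finite E] (P : DPSystem E) (n : E → ℕ) (k : ℕ) :
    (intPoints P n k).Finite := by
  choose x hx using P.exists_inc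
  choose y hy using hx
  have hfin : ((Set.range fun q : E × Fin (k + 1) => (q.1, x q.1, (q.2 : ℕ))) ∪
      Set.range fun q : E × Fin (k + 1) => (q.1, y q.1, (q.2 : ℕ))).Finite :=
    (Set.finite_range _).union (Set.finite_range _)
  refine hfin.subset ?_
  rintro ⟨e, z, s⟩ ⟨hz, -, hs, -⟩
  obtain rfl | rfl := hz.eq_or_eq_of_isLink (hy e)
  · exact Or.inl ⟨(e, ⟨s, Nat.lt_succ_of_le hs⟩), rfl⟩
  · exact Or.inr ⟨(e, ⟨s, Nat.lt_succ_of_le hs⟩), rfl⟩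

open Classical in
/-- A point is replaced by the point produced on the same edge when it reaches a vertex at time
`k`. -/
noncomputable def bounce (P : DPSystem E) (n : E → ℕ) (k : ℕ) (p : E × P.Vertex × ℕ) :
    E × P.Vertex × ℕ :=
  if h : P.graph.Inc p.1 p.2.1 then
    if p.2.2 + n p.1 = k then (p.1, h.other, k) else p
  else p

theorem bounce_of_eq {y : P.Vertex} {e : E} {s k : ℕ} (he : P.graph.IsLink e x y)
    (hs : s + n e = k) : bounce P n k (e, x, s) = (e, y, k) := by
  have h : P.graph.Inc e x := ⟨y, he⟩
  simp [bounce, h, hs, h.isLink_other.right_unique he]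

theorem bounce_of_ne {e : E} {s k : ℕ} (hs : s + n e ≠ k) : bounce P n k (e, x, s) = (e, x, s) := by
  simp [bounce, hs]

theorem bounce_mem (hn : ∀ e, 0 < n e) {k : ℕ} {p : E × P.Vertex × ℕ} (hp : p ∈ intPoints P n k) :
    bounce P n (k + 1) p ∈ intPoints P n (k + 1) := by
  obtain ⟨e, x, s⟩ := p
  obtain ⟨⟨y, he⟩, hx, hs, hk⟩ := hp
  simp only at he hx hs hk
  by_cases h : s + n e = k + 1
  · rw [bounce_of_eq he h]
    have := hn e
    exact ⟨he.inc_right, h ▸ cover_link hx he, le_rfl, by simp only; omega⟩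
  · rw [bounce_of_ne h]
    exact ⟨he.inc_left, hx, by simp only; omega, by simp only; omega⟩

/-- Points that fuse arrive along distinct edges and each bounces on its own edge, so fusion loses
none. -/
theorem bounce_injOn (P : DPSystem E) (n : E → ℕ) (k : ℕ) :
    Set.InjOn (bounce P n (k + 1)) (intPoints P n k) := by
  rintro ⟨e, x, s⟩ ⟨⟨y, he⟩, -, hs, -⟩ ⟨e', x', s'⟩ ⟨⟨y', he'⟩, -, hs', -⟩ heq
  simp only at he hs he' hs'
  by_cases h : s + n e = k + 1 <;> by_cases h' : s' + n e' = k + 1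
  · rw [bounce_of_eq he h, bounce_of_eq he' h', Prod.mk.injEq, Prod.mk.injEq] at heq
    obtain ⟨rfl, rfl, -⟩ := heq
    obtain rfl := he.left_unique he'
    obtain rfl : s = s' := by omega
    rfl
  · rw [bounce_of_eq he h, bounce_of_ne h', Prod.mk.injEq, Prod.mk.injEq] at heq
    omega
  · rw [bounce_of_ne h, bounce_of_eq he' h', Prod.mk.injEq, Prod.mk.injEq] at heq
    omega
  · rwa [bounce_of_ne h, bounce_of_ne h'] at heq

theorem encard_intPoints_le (hn : ∀ e, 0 < n e) (P : DPSystem E) (k : ℕ) :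
    (intPoints P n k).encard ≤ (intPoints P n (k + 1)).encard := by
  rw [← (bounce_injOn P n k).encard_image]
  exact Set.encard_le_encard (Set.image_subset_iff.2 fun p hp => bounce_mem hn hp)

/-- A point that is not a bounced one is newly produced on an edge along which nothing arrives, that
is, an instability. -/
theorem encard_intPoints_eq (hn : ∀ e, 0 < n e) {k : ℕ} (h : ¬ Unstable P n (k + 1)) :
    (intPoints P n (k + 1)).encard = (intPoints P n k).encard := by
  rw [← (bounce_injOn P n k).encard_image]
  refine congrArg _ (subset_antisymm ?_ (Set.image_subset_iff.2 fun p hp => bounce_mem hn hp))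
  rintro ⟨e, y, s⟩ ⟨⟨x, he⟩, hy, hs, hk⟩
  simp only at he hy hs hk
  by_cases hsk : s = k + 1
  · subst hsk
    by_contra hnot
    refine h ⟨x, y, e, he.symm, hy, fun j hj hjk => hnot ⟨(e, x, j), ⟨he.inc_right, hj, ?_, ?_⟩,
      bounce_of_eq he.symm hjk⟩⟩ <;> simp only <;> have := hn e <;> omega
  · refine ⟨(e, y, s), ⟨he.inc_left, hy, ?_, ?_⟩, bounce_of_ne ?_⟩ <;> (try simp only) <;> omega

theorem encard_intPoints_lt [Finite E] (hn : ∀ e, 0 < n e) {k : ℕ} (h : Unstable P n (k + 1)) :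
    (intPoints P n k).encard < (intPoints P n (k + 1)).encard := by
  rw [← (bounce_injOn P n k).encard_image]
  obtain ⟨x, y, e, he, hy, hno⟩ := h
  have hmem : (e, y, k + 1) ∈ intPoints P n (k + 1) :=
    ⟨he.inc_right, hy, le_rfl, Nat.lt_add_of_pos_right (hn e)⟩
  have hnot : (e, y, k + 1) ∉ bounce P n (k + 1) '' intPoints P n k := by
    rintro ⟨⟨e', x', s⟩, ⟨⟨y', he'⟩, hx, hs, -⟩, heq⟩
    simp only at he' hx hs
    by_cases h : s + n e' = k + 1
    · rw [bounce_of_eq he' h, Prod.mk.injEq, Prod.mk.injEq] at heq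
      obtain ⟨rfl, rfl, -⟩ := heq
      obtain rfl := he.left_unique he'
      exact hno s hx h
    · rw [bounce_of_ne h, Prod.mk.injEq, Prod.mk.injEq] at heq
      omega
  exact ((intPoints_finite P n k).image _).encard_lt_encard (ssubset_of_subset_of_ne
    (Set.image_subset_iff.2 fun p hp => bounce_mem hn hp) fun heq => hnot (heq ▸ hmem))

theorem encard_intPoints_mono (hn : ∀ e, 0 < n e) (P : DPSystem E) :
    Monotone fun k => (intPoints P n k).encard :=
  monotone_nat_of_le_succ (encard_intPoints_le hn P)

end Dynamics

/-! ### Real time, stabilization time and the common unit. -/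

section Stabilization

variable {E : Type u} {l : E → ℝ} {n : E → ℕ} {g : ℝ}

theorem scatters_iff (hl : ∀ e, l e = g * n e) (P : DPSystem E) {x : P.Vertex} {t : ℝ} :
    P.Scatters l x t ↔ ∃ k : ℕ, P.Cover n x [] k ∧ t = g * k := by
  constructor
  · intro h
    induction h with
    | start hx => exact ⟨0, ⟨_, hx, [], Walk.nil _, by simp, rfl⟩, by simp⟩
    | arrive _ he ih =>
      obtain ⟨k, hk, rfl⟩ := ih
      exact ⟨_, cover_link hk he, by rw [hl]; push_cast; ring⟩
  · rintro ⟨k, ⟨v, hv, L, hL, -, rfl⟩, rfl⟩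
    have key : ∀ {v y : P.Vertex} {L : List E}, Walk P.graph v L y → ∀ t, P.Scatters l v t →
        P.Scatters l y (t + g * weight n L) := by
      intro v y L hL
      induction hL with
      | nil => exact fun t ht => by simpa using ht
      | cons he _ ih =>
        intro t ht
        have := ih _ (ht.arrive he)
        convert this using 1
        rw [hl, weight_cons]
        push_cast
        ring
    simpa using key hL 0 (.start hv)

/-- Points are produced and arrive only at multiples of `g`, so the count is constant in between. -/
theorem numPoints_eq (hl : ∀ e, l e = g * n e) (hg : 0 < g) (P : DPSystem E) {t : ℝ}
    (ht : 0 ≤ t) : P.numPoints l t = (intPoints P n ⌊t / g⌋₊).encard := by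
  have hinj : Function.Injective fun p : E × P.Vertex × ℕ => (p.1, p.2.1, g * (p.2.2 : ℝ)) := by
    rintro ⟨e, x, s⟩ ⟨e', x', s'⟩ h
    simp only [Prod.mk.injEq, mul_eq_mul_left_iff, Nat.cast_inj, hg.ne', or_false] at h
    obtain ⟨rfl, rfl, rfl⟩ := h
    rfl
  have h₁ : ∀ s : ℕ, g * (s : ℝ) ≤ t ↔ s ≤ ⌊t / g⌋₊ := by
    intro s
    rw [Nat.le_floor_iff (by positivity), le_div_iff₀ hg, mul_comm]
  have h₂ : ∀ s : ℕ, t < g * (s : ℝ) ↔ ⌊t / g⌋₊ < s := fun s => by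
    rw [← not_le, ← not_le, h₁]
  rw [DPSystem.numPoints, ← hinj.encard_image]
  congr 1
  ext ⟨e, x, t'⟩
  simp only [DPSystem.points, intPoints, Set.mem_ofPred_eq, Set.mem_image, Prod.exists,
    scatters_iff hl, Prod.mk.injEq]
  constructor
  · rintro ⟨he, ⟨s, hs, rfl⟩, hle, hlt⟩
    refine ⟨e, x, s, ⟨he, hs, (h₁ s).1 hle, (h₂ _).1 ?_⟩, rfl, rfl, rfl⟩
    rw [hl] at hlt
    push_cast
    linarith
  · rintro ⟨e, x, s, ⟨he, hs, hle, hlt⟩, rfl, rfl, rfl⟩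
    refine ⟨he, ⟨s, hs, rfl⟩, (h₁ s).2 hle, ?_⟩
    have := (h₂ _).2 hlt
    push_cast at this
    rw [hl]
    linarith

theorem isStabilizationTime [Finite E] (hl : ∀ e, l e = g * n e) (hg : 0 < g)
    (hn : ∀ e, 0 < n e) {P : DPSystem E} {K : ℕ} (hK : IsGreatest {k | Unstable P n k} K) :
    P.IsStabilizationTime l (g * K) := by
  have hfloor : ∀ k : ℕ, ⌊g * (k : ℝ) / g⌋₊ = k := fun k => by
    rw [mul_div_cancel_left₀ _ hg.ne', Nat.floor_natCast]
  have hstep : ∀ k ≥ K, (intPoints P n k).encard = (intPoints P n K).encard := by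
    intro k hk
    induction k, hk using Nat.le_induction with
    | base => rfl
    | succ k hk ih =>
      rw [encard_intPoints_eq hn fun h => absurd (hK.2 h) (by omega), ih]
  refine ⟨⟨by positivity, fun t ht _ => ?_⟩, fun T hT => ?_⟩
  · have ht0 : 0 ≤ t := le_trans (by positivity) ht
    rw [numPoints_eq hl hg P ht0, numPoints_eq hl hg P (by positivity), hfloor]
    refine hstep _ ?_
    rw [ge_iff_le, Nat.le_floor_iff (by positivity), le_div_iff₀ hg, mul_comm]
    exact ht
  · obtain ⟨hT0, hT⟩ := hT
    by_contra! hlt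
    rcases K with _ | K
    · simp at hlt
      linarith
    have hhalf : ⌊g * ((K + 1 : ℕ) + 1 / 2 : ℝ) / g⌋₊ = K + 1 := by
      rw [mul_div_cancel_left₀ _ hg.ne', Nat.floor_eq_iff (by positivity)]
      constructor <;> norm_num
    -- At a half-integral multiple of `g` nothing arrives, so this is not a collision time, and the
    -- jump at `K + 1` is already counted there.
    have hnum := hT (g * ((K + 1 : ℕ) + 1 / 2 : ℝ)) (by nlinarith) (by
      rintro ⟨y, e, x, -, -, -, ⟨-, h⟩, -⟩
      obtain ⟨k, -, hk⟩ := (scatters_iff hl P).1 h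
      rw [hl] at hk
      have h₁ : g * (2 * (K + 1 : ℕ) + 1 : ℝ) = g * (2 * (k + n e)) := by linarith
      have h₂ := mul_left_cancel₀ hg.ne' h₁
      norm_cast at h₂
      omega)
    rw [numPoints_eq hl hg P (by positivity), numPoints_eq hl hg P hT0, hhalf] at hnum
    have hle : ⌊T / g⌋₊ ≤ K := by
      refine Nat.le_of_lt_succ ((Nat.floor_lt (by positivity)).2 ?_)
      rw [div_lt_iff₀ hg, mul_comm]
      exact hlt
    exact absurd hnum ((encard_intPoints_mono hn P hle).trans_lt
      (encard_intPoints_lt hn hK.1)).ne'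

/-- Commensurable lengths are integral multiples of one length, with coprime factors. -/
theorem Commensurable.exists_eq_mul [Finite E] [Nonempty E] (hl : Commensurable l)
    (hpos : ∀ e, 0 < l e) : ∃ (g : ℝ) (n : E → ℕ), 0 < g ∧ (∀ e, l e = g * n e) ∧
      (∀ e, 0 < n e) ∧ Nat.setGcd (Set.range n) = 1 := by
  have := Fintype.ofFinite E
  obtain ⟨e₀⟩ := ‹Nonempty E›
  choose q hq using fun e => hl e e₀
  have hq0 : ∀ e, 0 < q e := fun e => by
    have : (0 : ℝ) < q e := hq e ▸ div_pos (hpos e) (hpos e₀)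
    exact_mod_cast this
  -- `D` clears the denominators of the ratios to `l e₀`; the gcd of the resulting integers is then
  -- moved into the unit.
  set D := ∏ e, (q e).den with hD
  have hD0 : 0 < D := Finset.prod_pos fun e _ => (q e).den_pos
  have hm : ∀ e, ∃ m : ℕ, (m : ℚ) = q e * D := by
    intro e
    obtain ⟨c, hc⟩ : (q e).den ∣ D := Finset.dvd_prod_of_mem _ (Finset.mem_univ e)
    refine ⟨(q e).num.toNat * c, ?_⟩
    have hnum : (((q e).num.toNat : ℤ) : ℚ) = (q e).num := by
      rw [Int.toNat_of_nonneg (Rat.num_nonneg.2 (hq0 e).le)]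
    rw [hc]
    push_cast at hnum ⊢
    rw [hnum, ← mul_assoc, Rat.mul_den_eq_num]
  choose m hm using hm
  obtain ⟨n, hn, hgcd⟩ := Finset.extract_gcd m (s := Finset.univ) ⟨e₀, Finset.mem_univ e₀⟩
  have hle : ∀ e, l e = l e₀ / D * m e := by
    intro e
    have h₁ : (m e : ℝ) = q e * D := by exact_mod_cast hm e
    have h₂ : (D : ℝ) ≠ 0 := by exact_mod_cast hD0.ne'
    rw [h₁, ← hq e]
    have := (hpos e₀).ne'
    field_simp
  have hm0 : ∀ e, 0 < m e := by
    intro e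
    rw [Nat.pos_iff_ne_zero]
    intro h
    have := hpos e
    rw [hle e, h] at this
    simp at this
  have hgn : ∀ e, 0 < Finset.univ.gcd m ∧ 0 < n e := by
    intro e
    have := hm0 e
    rw [hn e (Finset.mem_univ e)] at this
    exact ⟨Nat.pos_of_mul_pos_right this, Nat.pos_of_mul_pos_left this⟩
  refine ⟨l e₀ / D * (Finset.univ.gcd m : ℕ), n, ?_, fun e => ?_, fun e => (hgn e).2, ?_⟩
  · have h₁ : (0 : ℝ) < D := by exact_mod_cast hD0
    have h₂ : (0 : ℝ) < (Finset.univ.gcd m : ℕ) := by exact_mod_cast (hgn e₀).1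
    exact mul_pos (div_pos (hpos e₀) h₁) h₂
  · rw [hle e, hn e (Finset.mem_univ e)]
    push_cast
    ring
  · rw [← Nat.dvd_one, ← hgcd]
    exact Finset.dvd_gcd fun e _ => Nat.setGcd_dvd_of_mem ⟨e, rfl⟩

theorem exists_isGreatest {s : Set ℕ} (hs : s.Nonempty) {B : ℕ} (hB : ∀ k ∈ s, k ≤ B) :
    ∃ K, IsGreatest s K :=
  ⟨sSup s, Nat.sSup_mem hs ⟨B, hB⟩, fun _ hk => le_csSup ⟨B, hB⟩ hk⟩

theorem nonempty_dpSystem [Finite E] [Nonempty E] : Nonempty (DPSystem E) := by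
  have := Fintype.ofFinite E
  have hlen : 0 < (Finset.univ : Finset E).toList.length := by
    simp [Fintype.card_pos]
  exact ⟨chordedPath Finset.univ.toList _ _ (by omega)
    (Or.inr ⟨Nat.sub_add_cancel hlen, rfl⟩) (by simp) (Finset.nodup_toList _)⟩

end Stabilization

end DynamicPoints

theorem mainTheorem1 {E : Type*} [Finite E] [Nonempty E] (l : E → ℝ)
    (hpos : ∀ e, 0 < l e) (hcomm : DynamicPoints.Commensurable l) :
    ∃ P ∈ DynamicPoints.LSTDP l,
      DynamicPoints.IsBead P.graph ∧
      (∀ x ∈ P.graph.vertexSet, DynamicPoints.degree P.graph x ≤ 3) ∧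
      ∃ x₀ : P.Vertex, P.initial = {x₀} ∧ DynamicPoints.IsTerminal P.graph x₀ := by
  obtain ⟨g, n, hg, hl, hn, hgcd⟩ := hcomm.exists_eq_mul hpos
  obtain ⟨B, hB⟩ := DynamicPoints.exists_unstable_le hgcd
  obtain ⟨P₀⟩ := DynamicPoints.nonempty_dpSystem (E := E)
  obtain ⟨K, ⟨Q, hQ⟩, hmax⟩ := DynamicPoints.exists_isGreatest
    (s := {k | ∃ Q, DynamicPoints.Unstable Q n k}) (B := B)
    ⟨0, P₀, DynamicPoints.unstable_zero hn P₀⟩ fun k ⟨Q, hQ⟩ => hB Q k hQ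
  obtain ⟨P, hP, k, hKk, hk⟩ := DynamicPoints.exists_isTerminalBead_unstable hgcd hn hQ
  -- Maximality of `K` over all systems makes the later instability coincide with it.
  obtain rfl : k = K := le_antisymm (hmax ⟨P, hk⟩) hKk
  refine ⟨P, ⟨g * k, DynamicPoints.isStabilizationTime hl hg hn ⟨hk, fun j hj => hmax ⟨P, hj⟩⟩,
    fun R => ?_⟩, hP⟩
  obtain ⟨j, hj⟩ := DynamicPoints.exists_isGreatest (s := {k | DynamicPoints.Unstable R n k})
    ⟨0, DynamicPoints.unstable_zero hn R⟩ fun k => hB R k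
  refine ⟨g * j, ?_, DynamicPoints.isStabilizationTime hl hg hn hj⟩
  have : (j : ℝ) ≤ k := by exact_mod_cast hmax ⟨R, hj.1⟩
  exact mul_le_mul_of_nonneg_left this hg.le
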